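/- **Setting.** All manifolds are finite-dimensional, smooth, without boundary, Hausdorff and second countable. Let $Q$ be a manifold and $\pi_Q:T^*Q\to Q$ its cotangent bundle with the canonical symplectic form $\omega=dq^i\wedge dp_i$. Let $G$ be a Lie group with Lie algebra $\mathfrak g$, acting smoothly on the left on $Q$, such that the cotangent lifted action on $T^*Q$ is free and proper and admits an $\mathrm{Ad}^*$-equivariant momentum map $\mathbf J:T^*Q\to\mathfrak g^*$. *The nonholonomic RCH system.* Let $L:TQ\to\mathbb R$ be a smooth hyperregular Lagrangian, i.e. its Legendre transformation $\mathcal FL:TQ\to T^*Q$ is a diffeomorphism, and let $H:T^*Q\to\mathbb R$ be its Hamiltonian, $H(\mathcal FL(v))=\langle \mathcal FL(v),v\rangle-L(v)$, with Hamiltonian vector field $X_H$ given by $\mathbf i_{X_H}\omega=\mathbf dH$. Let $\mathcal D\subset TQ$ be a smooth distribution of constant rank which is completely nonholonomic ($\mathcal D$ and its iterated brackets span $TQ$) and such that $L$ is $\mathcal D$-regular (the fibre Hessian of $L$, at points of $\mathcal D$ and restricted to $\mathcal D$, is nondegenerate). Let $F:T^*Q\to T^*Q$ (the force) be a smooth fiber-preserving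 map, $W\subset T^*Q$ (the control subset) a subset, and $u:T^*Q\to W$ (the control law) a smooth fiber-preserving map. Assume that $\mathcal D,H,F,W$ are $G$-invariant. For a fiber-preserving map $F$, and relative to a fixed splitting of $T(T^*Q)$ into horizontal and vertical parts, $\mathrm{vlift}(F)X_H(\alpha_x)$ is the vertical part of $TF(X_H(\alpha_x))$, displaced parallelly along the line in $T_x^*Q$ from $F(\alpha_x)$ to $\alpha_x$. *The distributional RCH system.* Put $\mathcal M=\mathcal FL(\mathcal D)$, a submanifold of $T^*Q$, $\mathcal F=(T\pi_Q)^{-1}(\mathcal D)$ and $\mathcal K=\mathcal F\cap T\mathcal M$. Assume $\dim\mathcal M=\operatorname{rank}\mathcal F$, $T\mathcal M\cap\mathcal F^\perp=\{0\}$, and that the restriction $\omega_{\mathcal K}$ of $\omega$ to $\mathcal K$ is nondegenerate. Let $\tau_{\mathcal K}$ be the $\omega$-orthogonal projection onto $\mathcal K$, let $X_{\mathcal K}$ be the vector field on $\mathcal M$ with values in $\mathcal K$ such that $\omega_{\mathcal K}(X_{\mathcal K},w)=\mathbf dH(w)$ for all $w\in\mathcal K$, and let $F_{\mathcal K}=\tau_{\mathcal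 K}\cdot\mathrm{vlift}(F)X_H$, $u_{\mathcal K}=\tau_{\mathcal K}\cdot\mathrm{vlift}(u)X_H$ and $\tilde X=X_{\mathcal K}+F_{\mathcal K}+u_{\mathcal K}$ on $\mathcal M$. *The reduced system.* Let $\mu\in\mathfrak g^*$ be a regular value of $\mathbf J$, and $\mathcal O_\mu$ its coadjoint orbit. Let $(T^*Q)_{\mathcal O_\mu}=\mathbf J^{-1}(\mathcal O_\mu)/G$, with projection $\pi_{\mathcal O_\mu}$ from $\mathbf J^{-1}(\mathcal O_\mu)$ and with the reduced form $\omega_{\mathcal O_\mu}$ determined by $i_{\mathcal O_\mu}^*\omega=\pi_{\mathcal O_\mu}^*\omega_{\mathcal O_\mu}+\mathbf J_{\mathcal O_\mu}^*\omega^+_{\mathcal O_\mu}$, where $i_{\mathcal O_\mu}$ is the inclusion of $\mathbf J^{-1}(\mathcal O_\mu)$ in $T^*Q$, $\mathbf J_{\mathcal O_\mu}=\mathbf J\circ i_{\mathcal O_\mu}$, and $\omega^+_{\mathcal O_\mu}(\nu)(\xi_{\mathfrak g^*}(\nu),\eta_{\mathfrak g^*}(\nu))=\langle\nu,[\xi,\eta]\rangle$.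 Let $h_{\mathcal O_\mu}$ be the function on $(T^*Q)_{\mathcal O_\mu}$ induced by $H$. Assume that $F(\mathbf J^{-1}(\mathcal O_\mu))\subset\mathbf J^{-1}(\mathcal O_\mu)$, that $W\cap\mathbf J^{-1}(\mathcal O_\mu)\ne\emptyset$, and that $\mathcal M$ and $\mathbf J^{-1}(\mathcal O_\mu)$ intersect cleanly in a nonempty manifold. Let $\mathcal M_{\mathcal O_\mu}=(\mathcal M\cap\mathbf J^{-1}(\mathcal O_\mu))/G\subset(T^*Q)_{\mathcal O_\mu}$, a manifold onto which $\mathcal M\cap\mathbf J^{-1}(\mathcal O_\mu)$ projects by a submersion, again denoted $\pi_{\mathcal O_\mu}$. Put $\mathcal F_{\mathcal O_\mu}=T\pi_{\mathcal O_\mu}(\mathcal F\cap T\mathbf J^{-1}(\mathcal O_\mu))$ and $\mathcal K_{\mathcal O_\mu}=\mathcal F_{\mathcal O_\mu}\cap T\mathcal M_{\mathcal O_\mu}$, and assume that the restriction $\omega_{\mathcal K_{\mathcal O_\mu}}$ of $\omega_{\mathcal O_\mu}$ to $\mathcal K_{\mathcal O_\mu}$ is nondegenerate. Let $X_{\mathcal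 K_{\mathcal O_\mu}}$ be the vector field on $\mathcal M_{\mathcal O_\mu}$ with values in $\mathcal K_{\mathcal O_\mu}$ such that $\omega_{\mathcal K_{\mathcal O_\mu}}(X_{\mathcal K_{\mathcal O_\mu}},w)=\mathbf dh_{\mathcal O_\mu}(w)$ for all $w\in\mathcal K_{\mathcal O_\mu}$. Assume moreover that, along $\mathcal M\cap\mathbf J^{-1}(\mathcal O_\mu)$, the fields $F_{\mathcal K}$ and $u_{\mathcal K}$ are tangent to this manifold and are pushed down by $T\pi_{\mathcal O_\mu}$ to vector fields on $\mathcal M_{\mathcal O_\mu}$, whose $\omega_{\mathcal O_\mu}$-orthogonal projections to $\mathcal K_{\mathcal O_\mu}$ are the reduced force and control fields $f_{\mathcal K_{\mathcal O_\mu}}$ and $u_{\mathcal K_{\mathcal O_\mu}}$. **Theorem 5.12.** In this setting, let $\gamma:Q\to T^*Q$ be a smooth, $G$-invariant one-form (i.e. $\gamma(g\cdot q)=g\cdot\gamma(q)$) with $\mathrm{Im}(\gamma)\subset\mathcal M\cap\mathbf J^{-1}(\mu)$, put $\bar\gamma_{\mathcal O_\mu}=\pi_{\mathcal O_\mu}\circ\gamma:Q\to\mathcal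 M_{\mathcal O_\mu}$, and assume $\mathrm{Im}(T\bar\gamma_{\mathcal O_\mu})\subset\mathcal K_{\mathcal O_\mu}$. Let $\varepsilon:T^*Q\to T^*Q$ be a symplectic map which is $G$-invariant (i.e. $\varepsilon(g\cdot z)=g\cdot\varepsilon(z)$) and satisfies $\varepsilon(\mathcal M\cap\mathbf J^{-1}(\mathcal O_\mu))\subset\mathcal M\cap\mathbf J^{-1}(\mathcal O_\mu)$. On $\mathcal M\cap\mathbf J^{-1}(\mathcal O_\mu)$ put $\bar\varepsilon_{\mathcal O_\mu}=\pi_{\mathcal O_\mu}\circ\varepsilon$ and $\tilde X^\varepsilon=T\pi_Q\cdot\tilde X\cdot\varepsilon$. Then $\varepsilon$ solves the Type II Hamilton–Jacobi equation $$T\gamma\cdot\tilde X^\varepsilon=X_{\mathcal K}\cdot\varepsilon\qquad\text{on }\mathcal M\cap\mathbf J^{-1}(\mathcal O_\mu)$$ of the distributional RCH system if and only if $\varepsilon$ and $\bar\varepsilon_{\mathcal O_\mu}$ solve the Type II Hamilton–Jacobi equation $$T\bar\gamma_{\mathcal O_\mu}\cdot\tilde X^\varepsilon=X_{\mathcal K_{\mathcal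 O_\mu}}\cdot\bar\varepsilon_{\mathcal O_\mu}\qquad\text{on }\mathcal M\cap\mathbf J^{-1}(\mathcal O_\mu)$$ of the $R_o$-reduced distributional RCH system. -/

import Mathlib

open scoped Manifold ContDiff Topology
open Bundle

universe u v

noncomputable section

/-! ## Manifolds, submanifolds, cotangent bundles -/

/-- A finite-dimensional smooth manifold without boundary (Hausdorff, second countable). -/
structure SmoothMfd : Type (u + 1) where
  carrier : Type u
  dim : ℕ
  [top : TopologicalSpace carrier]
  [charted : ChartedSpace (EuclideanSpace ℝ (Fin dim)) carrier]
  [mfd : IsManifold (𝓡 dim) ∞ carrier]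
  [t2 : T2Space carrier]
  [sc : SecondCountableTopology carrier]

namespace SmoothMfd

instance : CoeSort SmoothMfd.{u} (Type u) := ⟨SmoothMfd.carrier⟩

attribute [instance] SmoothMfd.top SmoothMfd.charted SmoothMfd.mfd SmoothMfd.t2 SmoothMfd.sc

/-- The model vector space of a manifold. -/
abbrev E (X : SmoothMfd.{u}) : Type := EuclideanSpace ℝ (Fin X.dim)

/-- The model with corners of a manifold. -/
abbrev I (X : SmoothMfd.{u}) : ModelWithCorners ℝ X.E X.E := 𝓡 X.dim

/-- The cotangent space `T*_x Q`. -/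
abbrev CotFiber (Q : SmoothMfd.{u}) (x : Q) : Type := TangentSpace Q.I x →L[ℝ] Trivial Q ℝ x

/-- The cotangent bundle `T*Q`, with its smooth structure as a bundle of linear maps. -/
abbrev Cot (Q : SmoothMfd.{u}) : Type u :=
  TotalSpace (Q.E →L[ℝ] ℝ) (fun x : Q => Q.CotFiber x)

/-- The model with corners of `T*Q`. -/
abbrev CI (Q : SmoothMfd.{u}) :
    ModelWithCorners ℝ (Q.E × (Q.E →L[ℝ] ℝ)) (ModelProd Q.E (Q.E →L[ℝ] ℝ)) :=
  Q.I.prod 𝓘(ℝ, Q.E →L[ℝ] ℝ)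

/-- The cotangent bundle projection `π_Q : T*Q → Q`. -/
def proj (Q : SmoothMfd.{u}) (z : Q.Cot) : Q := z.1

/-- The components `(dq, dp)` of a tangent vector of `T*Q` at `z` in the canonical cotangent
coordinates `(q, p)` around `z` (the preferred chart of the bundle `T*Q` at `z` is
`(x, α) ↦ (q(x), p)`, where `q` is the preferred chart of `Q` at the base point of `z` and `p`
is the expression of `α` in the coordinates `q`). -/
def dqdp (Q : SmoothMfd.{u}) (z : Q.Cot) : TangentSpace Q.CI z →L[ℝ] Q.E × (Q.E →L[ℝ] ℝ) :=
  mvfderiv Q.CI (extChartAt Q.CI z) z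

/-- The canonical symplectic form `ω = dqⁱ ∧ dpᵢ` on `T*Q`. -/
def omega (Q : SmoothMfd.{u}) (z : Q.Cot) (v w : TangentSpace Q.CI z) : ℝ :=
  (Q.dqdp z w).2 (Q.dqdp z v).1 - (Q.dqdp z v).2 (Q.dqdp z w).1

/-- A symplectic map `T*Q → T*Q`: smooth, with `ε^* ω = ω`. -/
def IsSymplecticMap (Q : SmoothMfd.{u}) (ε : Q.Cot → Q.Cot) : Prop :=
  ContMDiff Q.CI Q.CI ∞ ε ∧ ∀ z (v w : TangentSpace Q.CI z),
    Q.omega (ε z) (mfderiv Q.CI Q.CI ε z v) (mfderiv Q.CI Q.CI ε z w) = Q.omega z v w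

/-- A fibrewise map `x ↦ (T*_x Q → T*_x Q)` as a fiber-preserving map `T*Q → T*Q`. -/
def tot (Q : SmoothMfd.{u}) (F : ∀ x : Q, Q.CotFiber x → Q.CotFiber x) (z : Q.Cot) : Q.Cot :=
  ⟨z.1, F z.1 z.2⟩

/-- A one-form as a map `Q → T*Q`. -/
def sec (Q : SmoothMfd.{u}) (γ : ∀ x : Q, Q.CotFiber x) (x : Q) : Q.Cot := ⟨x, γ x⟩

/-- The vertical lift of `β ∈ T*_x Q` at `a ∈ T*_x Q`, i.e. `d/ds (a + s β)` at `s = 0`: the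
image of `β` under the derivative at `a` of the inclusion of the fibre `T*_x Q` in `T*Q`. -/
def vertLift (Q : SmoothMfd.{u}) (x : Q) (a β : Q.CotFiber x) :
    TangentSpace Q.CI (⟨x, a⟩ : Q.Cot) :=
  mfderiv 𝓘(ℝ, Q.E →L[ℝ] ℝ) Q.CI (fun b : Q.E →L[ℝ] ℝ => (⟨x, b⟩ : Q.Cot)) a β

/-- A smooth vector field on `Q`. -/
def IsSmoothVF (Q : SmoothMfd.{u}) (X : ∀ x : Q, TangentSpace Q.I x) : Prop :=
  ContMDiff Q.I Q.I.tangent ∞ (fun x => (⟨x, X x⟩ : TangentBundle Q.I Q))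

/-- A smooth vector field with values in the distribution `D`. -/
def IsSectionOf (Q : SmoothMfd.{u}) (D : ∀ x : Q, Submodule ℝ (TangentSpace Q.I x))
    (X : ∀ x : Q, TangentSpace Q.I x) : Prop :=
  Q.IsSmoothVF X ∧ ∀ x, X x ∈ D x

/-- A smooth distribution of constant rank `k`: it is spanned at every point by the values of its
smooth sections. -/
def IsSmoothDistribution (Q : SmoothMfd.{u}) (D : ∀ x : Q, Submodule ℝ (TangentSpace Q.I x))
    (k : ℕ) : Prop :=
  (∀ x, Module.finrank ℝ (D x) = k) ∧
    ∀ x, ∀ v ∈ D x, ∃ X, Q.IsSectionOf D X ∧ X x = v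

/-- The vector fields obtained from the sections of `D` by iterated brackets
`[D, [D, …, [D, D]]]`. -/
inductive IteratedBracket (Q : SmoothMfd.{u}) (D : ∀ x : Q, Submodule ℝ (TangentSpace Q.I x)) :
    (∀ x : Q, TangentSpace Q.I x) → Prop
  | base (X) (hX : Q.IsSectionOf D X) : IteratedBracket Q D X
  | bracket (X Y) (hX : Q.IsSectionOf D X) (hY : IteratedBracket Q D Y) :
      IteratedBracket Q D (VectorField.mlieBracket Q.I X Y)

/-- `D` is completely nonholonomic (bracket-generating). -/
def IsCompletelyNonholonomic (Q : SmoothMfd.{u})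
    (D : ∀ x : Q, Submodule ℝ (TangentSpace Q.I x)) : Prop :=
  ∀ x, Submodule.span ℝ {v : TangentSpace Q.I x | ∃ Y, Q.IteratedBracket D Y ∧ v = Y x} = ⊤

/-- The Legendre transformation (fibre derivative) `FL : TQ → T*Q` of a Lagrangian. -/
def legendre (Q : SmoothMfd.{u}) (L : TangentBundle Q.I Q → ℝ) (v : TangentBundle Q.I Q) :
    Q.Cot :=
  ⟨v.1, fderiv ℝ (fun w : TangentSpace Q.I v.1 => L ⟨v.1, w⟩) v.2⟩

/-- The fibre Hessian `∂²L/∂q̇∂q̇` of a Lagrangian at `u ∈ T_x Q`. -/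
def hessian (Q : SmoothMfd.{u}) (L : TangentBundle Q.I Q → ℝ) (x : Q)
    (u v w : TangentSpace Q.I x) : ℝ :=
  deriv (fun s : ℝ => ((Q.legendre L ⟨x, u + s • v⟩).2 w : ℝ)) 0

/-- `X` is the Hamiltonian vector field of `H` on `T*Q`: `i_X ω = dH`. -/
def IsHamiltonianVF (Q : SmoothMfd.{u}) (H : Q.Cot → ℝ) (X : ∀ z : Q.Cot, TangentSpace Q.CI z) :
    Prop :=
  ∀ z w, Q.omega z (X z) w = mvfderiv Q.CI H z w

/-- A smooth splitting of `T(T*Q)` into horizontal and vertical part, given by the map which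
sends a tangent vector at `z ∈ T*_x Q` to its vertical part, an element of
`ker T_z π_Q = T*_x Q`. -/
structure Splitting (Q : SmoothMfd.{u}) where
  vert : ∀ z : Q.Cot, TangentSpace Q.CI z →L[ℝ] Q.CotFiber z.1
  vert_vertLift : ∀ (x : Q) (a β : Q.CotFiber x), vert ⟨x, a⟩ (Q.vertLift x a β) = β
  smooth : ContMDiff Q.CI.tangent Q.CI ∞
    (fun v : TangentBundle Q.CI Q.Cot => (⟨v.1.1, vert v.1 v.2⟩ : Q.Cot))

/-- The vertical lift `vlift(F)X`: the vertical part of `TF(X(z)) ∈ T_{F(z)} T*Q`, displaced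
parallelly from `F(z)` to `z` along the straight line joining them in the fibre. -/
def vlift (Q : SmoothMfd.{u}) (A : Q.Splitting) (F : ∀ x : Q, Q.CotFiber x → Q.CotFiber x)
    (X : ∀ z : Q.Cot, TangentSpace Q.CI z) (z : Q.Cot) : TangentSpace Q.CI z :=
  Q.vertLift z.1 z.2 (A.vert (Q.tot F z) (mfderiv Q.CI Q.CI (Q.tot F) z (X z)))

/-- `N`, with the map `ι : N → T*Q`, is the subset `S` of `T*Q` with its structure of (initial)
submanifold: `ι` is a smooth injective immersion with image `S`, and a map into `N`, defined on an
open subset of a Euclidean space, is smooth as soon as its composition with `ι` is. There is at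
most one such structure on `S`; for an embedded submanifold it is the usual one. -/
structure IsSubmanifold (Q N : SmoothMfd.{u}) (ι : N → Q.Cot) (S : Set Q.Cot) : Prop where
  smooth : ContMDiff N.I Q.CI ∞ ι
  immersion : ∀ x, Function.Injective (mfderiv N.I Q.CI ι x)
  injective : Function.Injective ι
  range_eq : Set.range ι = S
  initial : ∀ (k : ℕ) (U : Set (EuclideanSpace ℝ (Fin k))) (f : EuclideanSpace ℝ (Fin k) → N),
    IsOpen U → ContMDiffOn (𝓡 k) Q.CI ∞ (fun x => ι (f x)) U → ContMDiffOn (𝓡 k) N.I ∞ f U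

/-- A surjective submersion. -/
structure IsSurjSubmersion {X Y : SmoothMfd.{u}} (f : X → Y) : Prop where
  smooth : ContMDiff X.I Y.I ∞ f
  surjective : Function.Surjective f
  submersion : ∀ x, Function.Surjective (mfderiv X.I Y.I f x)

/-! ## Group actions and momentum maps -/

section Action

variable (Q : SmoothMfd.{u}) (G : SmoothMfd.{v}) [Group G] [MulAction G Q]

/-- The Lie algebra `𝔤 = T_1 G`, as a vector space (tangent spaces are copies of the model
space). -/
abbrev LieAlg (G : SmoothMfd.{v}) : Type := G.E

/-- The dual `𝔤*` of the Lie algebra. -/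
abbrev LieDual (G : SmoothMfd.{v}) : Type := G.E →L[ℝ] ℝ

/-- The Lie bracket of `𝔤` (that of left invariant vector fields). -/
def lieBr (G : SmoothMfd.{v}) [Group G] (ξ η : G.LieAlg) : G.LieAlg :=
  Bracket.bracket (L := GroupLieAlgebra G.I G) (M := GroupLieAlgebra G.I G) ξ η

/-- The adjoint action `Ad_g`, the derivative of `h ↦ g h g⁻¹` at `1`. -/
def Ad (G : SmoothMfd.{v}) [Group G] (g : G) : G.LieAlg →L[ℝ] G.LieAlg :=
  mfderiv G.I G.I (fun h : G => g * h * g⁻¹) 1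

/-- The (left) coadjoint action `g · ν = Ad^*_{g⁻¹} ν`. -/
def coAd (G : SmoothMfd.{v}) [Group G] (g : G) (ν : G.LieDual) : G.LieDual :=
  ν.comp (Ad G g⁻¹)

/-- The coadjoint orbit `O_μ` through `μ`. -/
def coadOrbit (G : SmoothMfd.{v}) [Group G] (μ : G.LieDual) : Set G.LieDual :=
  {ν | ∃ g : G, ν = coAd G g μ}

/-- The infinitesimal generator `ξ_{𝔤*}(ν)` of the coadjoint action. -/
def coadGen (G : SmoothMfd.{v}) [Group G] (ξ : G.LieAlg) (ν : G.LieDual) : G.LieDual :=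
  mvfderiv G.I (fun g : G => coAd G g ν) 1 ξ

variable {G}

/-- The cotangent lift of the action: `g · α_x = α_x ∘ (T_x Φ_g)⁻¹`. -/
def cotLift (g : G) (z : Q.Cot) : Q.Cot :=
  ⟨g • z.1, z.2.comp (mfderiv Q.I Q.I (fun x : Q => g • x) z.1).inverse⟩

/-- The infinitesimal generator `ξ_{T*Q}` of the cotangent lifted action (a tangent vector at
`1 · z = z`). -/
def cotGen (ξ : G.LieAlg) (z : Q.Cot) : TangentSpace Q.CI (Q.cotLift (1 : G) z) :=
  mfderiv G.I Q.CI (fun g : G => Q.cotLift g z) 1 ξ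

/-- `J` is an `Ad^*`-equivariant momentum map for the cotangent lifted action:
`d⟨J, ξ⟩ = i_{ξ_{T*Q}} ω` and `J(g · z) = Ad^*_{g⁻¹} J(z)`. -/
structure IsMomentumMap (J : Q.Cot → G.LieDual) : Prop where
  smooth : ContMDiff Q.CI 𝓘(ℝ, G.LieDual) ∞ J
  momentum : ∀ (ξ : G.LieAlg) (z : Q.Cot) (w : TangentSpace Q.CI (Q.cotLift (1 : G) z)),
    Q.omega (Q.cotLift (1 : G) z) (Q.cotGen ξ z) w =
      mvfderiv Q.CI (fun y => J y ξ) (Q.cotLift (1 : G) z) w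
  equivariant : ∀ (g : G) (z : Q.Cot), J (Q.cotLift g z) = coAd G g (J z)

end Action

/-! ## Nonholonomic RCH systems -/

/-- A nonholonomic RCH system with symmetry and momentum map `(T*Q, G, ω, J, D, H, F, W)`,
together with the Lagrangian `L` it comes from and a control law `u` with values in `W`. -/
structure NonholonomicRCH (Q : SmoothMfd.{u}) (G : SmoothMfd.{v}) [Group G]
    [LieGroup G.I ∞ G] [MulAction G Q] where
  smooth_action : ContMDiff (G.I.prod Q.I) Q.I ∞ (fun p : G × Q => p.1 • p.2)
  free : ∀ (g : G) (z : Q.Cot), Q.cotLift g z = z → g = 1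
  proper : IsProperMap (fun p : G × Q.Cot => (Q.cotLift p.1 p.2, p.2))
  /-- the momentum map -/
  J : Q.Cot → G.LieDual
  momentum : Q.IsMomentumMap J
  /-- the nonholonomic constraint -/
  D : ∀ x : Q, Submodule ℝ (TangentSpace Q.I x)
  rank : ℕ
  smooth_D : Q.IsSmoothDistribution D rank
  complete_D : Q.IsCompletelyNonholonomic D
  invariant_D : ∀ (g : G) (x : Q), ∀ v ∈ D x, mfderiv Q.I Q.I (fun y : Q => g • y) x v ∈ D (g • x)
  /-- the Lagrangian -/
  L : TangentBundle Q.I Q → ℝ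
  smooth_L : ContMDiff Q.I.tangent 𝓘(ℝ, ℝ) ∞ L
  hyperregular : ∃ Φ : Diffeomorph Q.I.tangent Q.CI (TangentBundle Q.I Q) Q.Cot ∞,
    ⇑Φ = Q.legendre L
  regular_D : ∀ x, ∀ u ∈ D x, ∀ v ∈ D x, (∀ w ∈ D x, Q.hessian L x u v w = 0) → v = 0
  /-- the Hamiltonian -/
  H : Q.Cot → ℝ
  smooth_H : ContMDiff Q.CI 𝓘(ℝ, ℝ) ∞ H
  legendre_H : ∀ v : TangentBundle Q.I Q, H (Q.legendre L v) = (Q.legendre L v).2 v.2 - L v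
  invariant_H : ∀ (g : G) z, H (Q.cotLift g z) = H z
  /-- the Hamiltonian vector field of `H` -/
  XH : ∀ z : Q.Cot, TangentSpace Q.CI z
  hamiltonian_XH : Q.IsHamiltonianVF H XH
  /-- the splitting used to form vertical lifts -/
  A : Q.Splitting
  /-- the external force map -/
  F : ∀ x : Q, Q.CotFiber x → Q.CotFiber x
  smooth_F : ContMDiff Q.CI Q.CI ∞ (Q.tot F)
  invariant_F : ∀ (g : G) z, Q.tot F (Q.cotLift g z) = Q.cotLift g (Q.tot F z)
  /-- the control subset -/
  W : Set Q.Cot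
  invariant_W : ∀ (g : G), ∀ z ∈ W, Q.cotLift g z ∈ W
  /-- the control law -/
  u : ∀ x : Q, Q.CotFiber x → Q.CotFiber x
  smooth_u : ContMDiff Q.CI Q.CI ∞ (Q.tot u)
  u_mem : ∀ z, Q.tot u z ∈ W

section Systems

variable {Q : SmoothMfd.{u}} {G : SmoothMfd.{v}} [Group G] [LieGroup G.I ∞ G] [MulAction G Q]

namespace NonholonomicRCH

variable (S : NonholonomicRCH Q G)

/-- The constraint submanifold `M = FL(D) ⊆ T*Q`, as a set. -/
def constraintSet : Set Q.Cot :=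
  Q.legendre S.L '' {v : TangentBundle Q.I Q | v.2 ∈ S.D v.1}

/-- The distribution `F = (Tπ_Q)⁻¹(D)` on `T*Q`. -/
def distF (z : Q.Cot) : Submodule ℝ (TangentSpace Q.CI z) :=
  (S.D (Q.proj z)).comap (mfderiv Q.CI Q.I Q.proj z).toLinearMap

/-- `J⁻¹(O_μ)`. -/
def orbitLevel (μ : G.LieDual) : Set Q.Cot := S.J ⁻¹' coadOrbit G μ

/-- `M ∩ J⁻¹(O_μ)`. -/
def constraintLevel (μ : G.LieDual) : Set Q.Cot := S.constraintSet ∩ S.orbitLevel μ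

end NonholonomicRCH

/-- The distributional RCH system `(K, ω_K, H_K, F_K, u_K)` of a nonholonomic RCH system. -/
structure DistributionalRCH (S : NonholonomicRCH Q G) where
  /-- the constraint submanifold -/
  M : SmoothMfd.{u}
  /-- the inclusion `i_M : M → T*Q` -/
  iM : M → Q.Cot
  submanifold : IsSubmanifold Q M iM S.constraintSet
  /-- admissibility: `dim M = rank F` -/
  admissible : ∀ m : M, M.dim = Module.finrank ℝ (S.distF (iM m))
  /-- compatibility: `TM ∩ F^⊥ = {0}` -/
  compatible : ∀ (m : M) (v : TangentSpace M.I m),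
    (∀ w ∈ S.distF (iM m), Q.omega (iM m) (mfderiv M.I Q.CI iM m v) w = 0) → v = 0
  /-- `ω_K` is nondegenerate on `K = F ∩ TM` -/
  nondegenerate : ∀ (m : M) (v : TangentSpace M.I m),
    mfderiv M.I Q.CI iM m v ∈ S.distF (iM m) →
    (∀ w : TangentSpace M.I m, mfderiv M.I Q.CI iM m w ∈ S.distF (iM m) →
      Q.omega (iM m) (mfderiv M.I Q.CI iM m v) (mfderiv M.I Q.CI iM m w) = 0) → v = 0
  /-- the nonholonomic dynamical vector field -/
  XK : ∀ m : M, TangentSpace M.I m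
  XK_mem : ∀ m, mfderiv M.I Q.CI iM m (XK m) ∈ S.distF (iM m)
  /-- the distributional Hamiltonian equation `i_{X_K} ω_K = dH_K` on `K` -/
  XK_eq : ∀ (m : M) (w : TangentSpace M.I m), mfderiv M.I Q.CI iM m w ∈ S.distF (iM m) →
    Q.omega (iM m) (mfderiv M.I Q.CI iM m (XK m)) (mfderiv M.I Q.CI iM m w) =
      mvfderiv M.I (fun m' => S.H (iM m')) m w
  /-- `F_K = τ_K · vlift(F) X_H` -/
  FK : ∀ m : M, TangentSpace M.I m
  FK_mem : ∀ m, mfderiv M.I Q.CI iM m (FK m) ∈ S.distF (iM m)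
  /-- `τ_K` is the `ω`-orthogonal projection onto `K`, so that `X_K = τ_K · X_H` -/
  FK_eq : ∀ (m : M) (w : TangentSpace M.I m), mfderiv M.I Q.CI iM m w ∈ S.distF (iM m) →
    Q.omega (iM m) (mfderiv M.I Q.CI iM m (FK m)) (mfderiv M.I Q.CI iM m w) =
      Q.omega (iM m) (Q.vlift S.A S.F S.XH (iM m)) (mfderiv M.I Q.CI iM m w)
  /-- `u_K = τ_K · vlift(u) X_H` -/
  uK : ∀ m : M, TangentSpace M.I m
  uK_mem : ∀ m, mfderiv M.I Q.CI iM m (uK m) ∈ S.distF (iM m)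
  uK_eq : ∀ (m : M) (w : TangentSpace M.I m), mfderiv M.I Q.CI iM m w ∈ S.distF (iM m) →
    Q.omega (iM m) (mfderiv M.I Q.CI iM m (uK m)) (mfderiv M.I Q.CI iM m w) =
      Q.omega (iM m) (Q.vlift S.A S.u S.XH (iM m)) (mfderiv M.I Q.CI iM m w)

namespace DistributionalRCH

variable {S : NonholonomicRCH Q G} (T : DistributionalRCH S)

/-- The point of the manifold `M` over a point of the set `M ⊆ T*Q`. -/
def lift (z : Q.Cot) (hz : z ∈ S.constraintSet) : T.M :=
  (show z ∈ Set.range T.iM from T.submanifold.range_eq ▸ hz).choose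

/-- The dynamical vector field `X̃ = X_K + F_K + u_K`, with values in `T(T*Q)`. -/
def Xtilde (m : T.M) : TangentBundle Q.CI Q.Cot :=
  tangentMap T.M.I Q.CI T.iM ⟨m, T.XK m + T.FK m + T.uK m⟩

end DistributionalRCH

/-- The regular orbit reduction at `μ` of `(T*Q, ω)` and of `M ∩ J⁻¹(O_μ)`. -/
structure OrbitReduction (S : NonholonomicRCH Q G) (T : DistributionalRCH S) (μ : G.LieDual) where
  regular : ∀ z, S.J z = μ → Function.Surjective (mvfderiv Q.CI S.J z)
  force_invariant : ∀ z ∈ S.orbitLevel μ, Q.tot S.F z ∈ S.orbitLevel μ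
  control_nonempty : (S.W ∩ S.orbitLevel μ).Nonempty
  /-- the submanifold `J⁻¹(O_μ)` -/
  P : SmoothMfd.{u}
  iP : P → Q.Cot
  submanifold_P : IsSubmanifold Q P iP (S.orbitLevel μ)
  /-- the reduced space `(T*Q)_{O_μ} = J⁻¹(O_μ) / G` -/
  R : SmoothMfd.{u}
  πP : P → R
  submersion_P : IsSurjSubmersion πP
  orbit_P : ∀ p p' : P, πP p = πP p' ↔ ∃ g : G, Q.cotLift g (iP p) = iP p'
  /-- the reduced symplectic form `ω_{O_μ}` -/
  ωO : ∀ r : R, TangentSpace R.I r →L[ℝ] TangentSpace R.I r →L[ℝ] ℝ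
  /-- `i^* ω = π^* ω_{O_μ} + J^* ω⁺`, where
  `ω⁺(ν)(ξ_{𝔤*}(ν), η_{𝔤*}(ν)) = ⟨ν, [ξ, η]⟩` -/
  ωO_eq : ∀ (p : P) (v w : TangentSpace P.I p) (ξ η : G.LieAlg),
    mvfderiv Q.CI S.J (iP p) (mfderiv P.I Q.CI iP p v) = coadGen G ξ (S.J (iP p)) →
    mvfderiv Q.CI S.J (iP p) (mfderiv P.I Q.CI iP p w) = coadGen G η (S.J (iP p)) →
    Q.omega (iP p) (mfderiv P.I Q.CI iP p v) (mfderiv P.I Q.CI iP p w) =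
      ωO (πP p) (mfderiv P.I R.I πP p v) (mfderiv P.I R.I πP p w)
        + S.J (iP p) (lieBr G ξ η)
  /-- the reduced Hamiltonian `h_{O_μ}` -/
  h : R → ℝ
  smooth_h : ContMDiff R.I 𝓘(ℝ, ℝ) ∞ h
  h_eq : ∀ p, h (πP p) = S.H (iP p)
  /-- `M ∩ J⁻¹(O_μ)`, a nonempty clean intersection -/
  nonempty : (S.constraintLevel μ).Nonempty
  N : SmoothMfd.{u}
  iN : N → Q.Cot
  submanifold_N : IsSubmanifold Q N iN (S.constraintLevel μ)
  clean : ∀ v : TangentBundle Q.CI Q.Cot, v ∈ Set.range (tangentMap T.M.I Q.CI T.iM) →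
    v ∈ Set.range (tangentMap P.I Q.CI iP) → v ∈ Set.range (tangentMap N.I Q.CI iN)
  /-- the reduced constraint submanifold `M_{O_μ} = (M ∩ J⁻¹(O_μ)) / G` -/
  MO : SmoothMfd.{u}
  πN : N → MO
  submersion_N : IsSurjSubmersion πN
  orbit_N : ∀ n n' : N, πN n = πN n' ↔ ∃ g : G, Q.cotLift g (iN n) = iN n'
  /-- the inclusion `M_{O_μ} → (T*Q)_{O_μ}` -/
  iMO : MO → R
  smooth_iMO : ContMDiff MO.I R.I ∞ iMO
  iMO_eq : ∀ n p, iN n = iP p → iMO (πN n) = πP p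

namespace OrbitReduction

variable {S : NonholonomicRCH Q G} {T : DistributionalRCH S} {μ : G.LieDual}
  (B : OrbitReduction S T μ)

/-- The distribution `F_{O_μ} = Tπ_{O_μ}(F)` on `(T*Q)_{O_μ}`. -/
def FO : Set (TangentBundle B.R.I B.R) :=
  tangentMap B.P.I B.R.I B.πP ''
    {v : TangentBundle B.P.I B.P | mfderiv B.P.I Q.CI B.iP v.1 v.2 ∈ S.distF (B.iP v.1)}

/-- The distribution `K_{O_μ} = F_{O_μ} ∩ TM_{O_μ}` on `M_{O_μ}`. -/
def KO (x : B.MO) : Set (TangentSpace B.MO.I x) :=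
  {w | tangentMap B.MO.I B.R.I B.iMO ⟨x, w⟩ ∈ B.FO}

/-- The form `ω_{M_{O_μ}} = i_{M_{O_μ}}^* ω_{O_μ}` on `M_{O_μ}`, whose restriction to `K_{O_μ}`
is `ω_{K_{O_μ}}`. -/
def ωMO (x : B.MO) (v w : TangentSpace B.MO.I x) : ℝ :=
  B.ωO (B.iMO x) (mfderiv B.MO.I B.R.I B.iMO x v) (mfderiv B.MO.I B.R.I B.iMO x w)

/-- The projection `π_{O_μ}` from the set `M ∩ J⁻¹(O_μ) ⊆ T*Q` to `M_{O_μ}`. -/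
def red (z : Q.Cot) (hz : z ∈ S.constraintLevel μ) : B.MO :=
  B.πN (show z ∈ Set.range B.iN from B.submanifold_N.range_eq ▸ hz).choose

theorem iN_mem (n : B.N) : B.iN n ∈ S.constraintLevel μ :=
  B.submanifold_N.range_eq ▸ Set.mem_range_self n

end OrbitReduction

/-- The `J`-nonholonomic `R_o`-reduced distributional RCH system
`(K_{O_μ}, ω_{K_{O_μ}}, h_{K_{O_μ}}, f_{K_{O_μ}}, u_{K_{O_μ}})`. -/
structure ReducedDistributionalRCH (S : NonholonomicRCH Q G) (T : DistributionalRCH S)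
    (μ : G.LieDual) extends OrbitReduction S T μ where
  /-- `ω_{K_{O_μ}}` is nondegenerate on `K_{O_μ}` -/
  nondegenerate : ∀ (x : MO), ∀ v ∈ toOrbitReduction.KO x,
    (∀ w ∈ toOrbitReduction.KO x, toOrbitReduction.ωMO x v w = 0) → v = 0
  /-- the reduced dynamical vector field `X_{K_{O_μ}}` -/
  XKO : ∀ x : MO, TangentSpace MO.I x
  XKO_mem : ∀ x, XKO x ∈ toOrbitReduction.KO x
  /-- the reduced distributional Hamiltonian equation `i_X ω_{K_{O_μ}} = dh_{K_{O_μ}}` -/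
  XKO_eq : ∀ (x : MO), ∀ w ∈ toOrbitReduction.KO x,
    toOrbitReduction.ωMO x (XKO x) w = mvfderiv MO.I (fun y => h (iMO y)) x w
  /-- `F_K` is pushed down to `M_{O_μ}` by `Tπ_{O_μ}` -/
  fMO : ∀ x : MO, TangentSpace MO.I x
  fMO_eq : ∀ (n : N) (m : T.M), T.iM m = iN n → ∃ v : TangentSpace N.I n,
    tangentMap N.I Q.CI iN ⟨n, v⟩ = tangentMap T.M.I Q.CI T.iM ⟨m, T.FK m⟩ ∧
      fMO (πN n) = mfderiv N.I MO.I πN n v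
  /-- `f_{K_{O_μ}} = τ_{K_{O_μ}} · f_{M_{O_μ}}` -/
  fKO : ∀ x : MO, TangentSpace MO.I x
  fKO_mem : ∀ x, fKO x ∈ toOrbitReduction.KO x
  fKO_eq : ∀ (x : MO), ∀ w ∈ toOrbitReduction.KO x,
    toOrbitReduction.ωMO x (fKO x) w = toOrbitReduction.ωMO x (fMO x) w
  /-- `u_K` is pushed down to `M_{O_μ}` by `Tπ_{O_μ}` -/
  uMO : ∀ x : MO, TangentSpace MO.I x
  uMO_eq : ∀ (n : N) (m : T.M), T.iM m = iN n → ∃ v : TangentSpace N.I n,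
    tangentMap N.I Q.CI iN ⟨n, v⟩ = tangentMap T.M.I Q.CI T.iM ⟨m, T.uK m⟩ ∧
      uMO (πN n) = mfderiv N.I MO.I πN n v
  /-- `u_{K_{O_μ}} = τ_{K_{O_μ}} · u_{M_{O_μ}}` -/
  uKO : ∀ x : MO, TangentSpace MO.I x
  uKO_mem : ∀ x, uKO x ∈ toOrbitReduction.KO x
  uKO_eq : ∀ (x : MO), ∀ w ∈ toOrbitReduction.KO x,
    toOrbitReduction.ωMO x (uKO x) w = toOrbitReduction.ωMO x (uMO x) w

/-! ## The two Type II Hamilton-Jacobi equations -/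

section HamiltonJacobi

variable {S : NonholonomicRCH Q G} {T : DistributionalRCH S} {μ : G.LieDual}
  (B : ReducedDistributionalRCH S T μ)

/-- `γ̄_{O_μ} = π_{O_μ} ∘ γ : Q → M_{O_μ}`. -/
def gammaBar (γ : ∀ x : Q, Q.CotFiber x) (hγ : ∀ q, Q.sec γ q ∈ S.constraintLevel μ) (q : Q) :
    B.MO :=
  B.red (Q.sec γ q) (hγ q)

/-- `ε̄_{O_μ} = π_{O_μ} ∘ ε : M ∩ J⁻¹(O_μ) → M_{O_μ}`. -/
def epsBar (ε : Q.Cot → Q.Cot)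
    (hε : ∀ z ∈ S.constraintLevel μ, ε z ∈ S.constraintLevel μ) (n : B.N) : B.MO :=
  B.red (ε (B.iN n)) (hε _ (B.iN_mem n))

/-- `X_K ∘ ε` on `M ∩ J⁻¹(O_μ)`, with values in `T(T*Q)`. -/
def XKEps (ε : Q.Cot → Q.Cot)
    (hε : ∀ z ∈ S.constraintLevel μ, ε z ∈ S.constraintLevel μ) (n : B.N) :
    TangentBundle Q.CI Q.Cot :=
  tangentMap T.M.I Q.CI T.iM
    ⟨T.lift (ε (B.iN n)) (hε _ (B.iN_mem n)).1, T.XK (T.lift (ε (B.iN n)) (hε _ (B.iN_mem n)).1)⟩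

/-- `X̃^ε = Tπ_Q ∘ X̃ ∘ ε` on `M ∩ J⁻¹(O_μ)`, with values in `TQ`. -/
def XtildeEps (ε : Q.Cot → Q.Cot)
    (hε : ∀ z ∈ S.constraintLevel μ, ε z ∈ S.constraintLevel μ) (n : B.N) :
    TangentBundle Q.I Q :=
  tangentMap Q.CI Q.I Q.proj (T.Xtilde (T.lift (ε (B.iN n)) (hε _ (B.iN_mem n)).1))

/-- `ε` solves the Type II Hamilton-Jacobi equation `Tγ · X̃^ε = X_K · ε`. -/
def SolvesTypeII (γ : ∀ x : Q, Q.CotFiber x) (ε : Q.Cot → Q.Cot)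
    (hε : ∀ z ∈ S.constraintLevel μ, ε z ∈ S.constraintLevel μ) : Prop :=
  ∀ n : B.N, tangentMap Q.I Q.CI (Q.sec γ) (XtildeEps B ε hε n) = XKEps B ε hε n

/-- `ε` and `ε̄_{O_μ}` solve the reduced Type II Hamilton-Jacobi equation
`Tγ̄_{O_μ} · X̃^ε = X_{K_{O_μ}} · ε̄_{O_μ}`. -/
def SolvesReducedTypeII (γ : ∀ x : Q, Q.CotFiber x)
    (hγ : ∀ q, Q.sec γ q ∈ S.constraintLevel μ) (ε : Q.Cot → Q.Cot)
    (hε : ∀ z ∈ S.constraintLevel μ, ε z ∈ S.constraintLevel μ) : Prop :=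
  ∀ n : B.N, tangentMap Q.I B.MO.I (gammaBar B γ hγ) (XtildeEps B ε hε n) =
    ⟨epsBar B ε hε n, B.XKO (epsBar B ε hε n)⟩

end HamiltonJacobi

end Systems

end SmoothMfd

end

/-! Write N for M ∩ J⁻¹(O_μ) and π for the projection of N onto M_{O_μ}.

Equality of base points already forces ε(z) to lie on the image of γ in both equations. With q =
π_Q(ε(z)), the unreduced equation gives γ(q) = ε(z). The reduced one gives γ(g • q) = g · γ(q) =
ε(z) for some g, and projecting to Q yields g • q = q, hence again γ(q) = ε(z). Off the image of γ
both equations fail, so only the points γ(q) have to be compared (`hamiltonJacobi_iff`).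

Invariance of γ and equivariance of J make O_μ the single point μ, so the coadjoint orbit form
disappears and the reduced form pulls back exactly to ω (`J_eq_of_mem_orbitLevel`, `omega_eq_ωO`).
Along γ, every vector of K_{O_μ} lifts to F ∩ TN (`exists_of_mem_KO`): the kernel of the projection
to the reduced space is the tangent space of the orbit, by a dimension count, and the orbit of γ(q)
stays in the image of γ, hence in N. By nondegeneracy of the reduced form, the reduced equation
therefore says that Tγ(w) - X_K is ω-orthogonal to F ∩ TN, where w = Tπ_Q(X̃) (`eq_XKO_iff`).

It remains to see that this orthogonality forces Tγ(w) = X_K (`eq_XK_of_omega_eq`). The vertical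
lifts are vertical, and admissibility with nondegeneracy of ω_K makes their projections F_K and u_K
vertical at points of γ, so w = Tπ_Q(X_K) and Tγ(w) - X_K is vertical. It is orthogonal to Tγ(D) ⊆ F
∩ TN and to all vertical vectors of TM; these together span K, so it vanishes. -/

namespace SmoothMfd

/-! ### Dimension counts -/

/-- The image of an open subset of a manifold under a `C^∞` map into a vector space has Hausdorff
dimension at most that of the manifold. -/
theorem dimH_image_le (X : SmoothMfd.{v}) {F : Type*} [NormedAddCommGroup F] [NormedSpace ℝ F]
    {f : X → F} {Ω : Set X} (hΩ : IsOpen Ω) (hf : ContMDiffOn X.I 𝓘(ℝ, F) ∞ f Ω) :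
    dimH (f '' Ω) ≤ X.dim := by
  -- Read in a chart, f is C¹ on a small ball, and a C¹ map on a convex set does not raise Hausdorff
  -- dimension. Second countability then reduces Ω to countably many such pieces.
  have key : ∀ x ∈ Ω, ∃ t ∈ 𝓝[Ω] x, dimH (f '' t) ≤ X.dim := by
    intro x hx
    have hcx := (hf x hx).contMDiffAt (hΩ.mem_nhds hx)
    have h1 := (contMDiffAt_iff.1 hcx).2
    simp only [ModelWithCorners.range_eq_univ, contDiffWithinAt_univ] at h1
    have h2 : ContDiffAt ℝ 1 (f ∘ (extChartAt X.I x).symm) (extChartAt X.I x x) :=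
      h1.of_le (by simp)
    obtain ⟨u, hu, hcu⟩ := h2.contDiffOn (m := 1) le_rfl (by simp)
    have hu' : u ∈ 𝓝 (extChartAt X.I x x) := by simpa using hu
    obtain ⟨r, hr, hball⟩ := Metric.mem_nhds_iff.1 hu'
    have h3 : ContDiffOn ℝ 1 (f ∘ (extChartAt X.I x).symm)
        (Metric.ball (extChartAt X.I x x) r) := hcu.mono hball
    refine ⟨(extChartAt X.I x).source ∩ extChartAt X.I x ⁻¹' Metric.ball (extChartAt X.I x x) r,
      ?_, ?_⟩
    · exact mem_nhdsWithin_of_mem_nhds (Filter.inter_mem (extChartAt_source_mem_nhds x)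
        ((continuousAt_extChartAt x).preimage_mem_nhds (Metric.ball_mem_nhds _ hr)))
    · calc dimH (f '' _) ≤ dimH ((f ∘ (extChartAt X.I x).symm) ''
            (Metric.ball (extChartAt X.I x x) r)) := by
            apply dimH_mono
            rintro _ ⟨y, ⟨hy1, hy2⟩, rfl⟩
            exact ⟨extChartAt X.I x y, hy2, congrArg f ((extChartAt X.I x).left_inv hy1)⟩
        _ ≤ dimH (Metric.ball (extChartAt X.I x x) r) :=
            h3.dimH_image_le (convex_ball _ _) subset_rfl
        _ ≤ dimH (Set.univ : Set X.E) := dimH_mono (Set.subset_univ _)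
        _ = X.dim := by rw [Real.dimH_univ_eq_finrank]; simp
  choose! t ht hd using key
  obtain ⟨s, hs, hsc, hcov⟩ := TopologicalSpace.countable_cover_nhdsWithin ht
  calc dimH (f '' Ω) ≤ dimH (⋃ x ∈ s, f '' t x) := by
        apply dimH_mono
        rw [← Set.image_iUnion₂]
        exact Set.image_mono hcov
    _ = ⨆ x ∈ s, dimH (f '' t x) := dimH_bUnion hsc _
    _ ≤ X.dim := iSup₂_le fun x hx => hd x (hs hx)

/-- If a fibre of a map is covered by the image of a manifold `X`, its dimension at a point where
the map is a submersion is at most that of `X`. -/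
theorem finrank_ker_le_of_fiber_subset_range {X : SmoothMfd.{v}} {P R : SmoothMfd.{u}} {ρ : P → R}
    {p : P} (hρ : ContMDiff P.I R.I ∞ ρ)
    (hsurj : Function.Surjective (mfderiv P.I R.I ρ p)) {σ : X → P} (hσ : ContMDiff X.I P.I ∞ σ)
    (hfib : ∀ p', ρ p' = ρ p → p' ∈ Set.range σ) :
    Module.finrank ℝ (mfderiv P.I R.I ρ p).ker ≤ X.dim := by
  set A : P.E →L[ℝ] R.E := mfderiv P.I R.I ρ p with hA
  -- A linear projection ℓ onto the kernel completes ρ, read in charts, to a map with surjective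
  -- derivative. This map is open at `a`, so ℓ maps the points of the fibre near p onto a
  -- neighbourhood in the kernel. That neighbourhood has the full dimension of the kernel and is
  -- covered by a smooth image of an open subset of X.
  obtain ⟨ℓ, hℓ⟩ : ∃ ℓ : P.E →L[ℝ] A.ker, ∀ x : A.ker, ℓ x = x :=
    Submodule.ClosedComplemented.of_finiteDimensional A.ker
  set φ := extChartAt P.I p
  set ψ := extChartAt R.I (ρ p)
  set f : P.E → R.E := ψ ∘ ρ ∘ φ.symm with hf
  set a : P.E := φ p
  have hfa : ContDiffAt ℝ ∞ f a := by
    have := (contMDiffAt_iff.1 (hρ p)).2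
    simpa only [ModelWithCorners.range_eq_univ, contDiffWithinAt_univ] using this
  have hmd : MDifferentiableAt P.I R.I ρ p := (hρ p).mdifferentiableAt (by simp)
  have hder : HasFDerivAt f A a := by
    have h : HasFDerivWithinAt f A (Set.range P.I) a := hmd.hasMFDerivAt.2
    rwa [ModelWithCorners.range_eq_univ, hasFDerivWithinAt_univ] at h
  have hstrict : HasStrictFDerivAt f A a := hfa.hasStrictFDerivAt' hder (by simp)
  have hΦ : HasStrictFDerivAt (fun x => (f x, ℓ x)) (A.prod ℓ) a :=
    hstrict.prodMk ℓ.hasStrictFDerivAt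
  have hrange : (A.prod ℓ).range = ⊤ := by
    rw [LinearMap.range_eq_top]
    rintro ⟨r, k⟩
    obtain ⟨x, hx'⟩ : ∃ x : P.E, A x = r := hsurj r
    refine ⟨x - (ℓ x : A.ker) + k, ?_⟩
    have h1 : A (ℓ x : A.ker) = 0 := (ℓ x).2
    have h2 : A (k : P.E) = 0 := k.2
    change (A (x - (ℓ x : A.ker) + k), ℓ (x - (ℓ x : A.ker) + k)) = (r, k)
    simp [hx', h1, h2, hℓ]
  have hmap := hΦ.map_nhds_eq_of_surj hrange
  -- the neighbourhood of `a` in which we look for points of the fibre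
  have hU : φ.target ∩ φ.symm ⁻¹' (ρ ⁻¹' ψ.source) ∈ 𝓝 a := by
    refine Filter.inter_mem (extChartAt_target_mem_nhds p) ?_
    have h1 : ContinuousAt φ.symm a := continuousAt_extChartAt_symm p
    apply h1.preimage_mem_nhds
    have h2 : φ.symm a = p := extChartAt_to_inv p
    rw [h2]
    exact hρ.continuous.continuousAt.preimage_mem_nhds (extChartAt_source_mem_nhds _)
  have hV : (fun x => (f x, ℓ x)) '' (φ.target ∩ φ.symm ⁻¹' (ρ ⁻¹' ψ.source)) ∈
      𝓝 (f a, ℓ a) := by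
    rw [← hmap]; exact Filter.image_mem_map hU
  have hW : {y : A.ker | (f a, y) ∈
      (fun x => (f x, ℓ x)) '' (φ.target ∩ φ.symm ⁻¹' (ρ ⁻¹' ψ.source))} ∈ 𝓝 (ℓ a) :=
    (Continuous.prodMk_right (f a)).continuousAt.preimage_mem_nhds hV
  have hsub : {y : A.ker | (f a, y) ∈
      (fun x => (f x, ℓ x)) '' (φ.target ∩ φ.symm ⁻¹' (ρ ⁻¹' ψ.source))} ⊆
      (fun x => ℓ (φ (σ x))) '' (σ ⁻¹' φ.source) := by
    rintro y ⟨x, ⟨hx1, hx2⟩, hx⟩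
    have hx3 : f x = f a := (Prod.ext_iff.1 hx).1
    have hx4 : ℓ x = y := (Prod.ext_iff.1 hx).2
    have h5 : ρ (φ.symm x) = ρ p := by
      have h6 : ψ (ρ (φ.symm x)) = ψ (ρ p) := by
        have h7 : φ.symm a = p := extChartAt_to_inv p
        simpa [hf, h7] using hx3
      exact ψ.injOn hx2 (mem_extChartAt_source _) h6
    obtain ⟨g, hg⟩ := hfib _ h5
    refine ⟨g, ?_, ?_⟩
    · rw [Set.mem_preimage, hg]; exact φ.map_target hx1
    · simp only [hg, φ.right_inv hx1, hx4]
  have hsm : ContMDiffOn X.I 𝓘(ℝ, A.ker) ∞ (fun x => ℓ (φ (σ x))) (σ ⁻¹' φ.source) := by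
    have h1 : ContMDiffOn P.I 𝓘(ℝ, P.E) ∞ φ φ.source := by
      have := contMDiffOn_extChartAt (I := P.I) (x := p) (n := ∞)
      rwa [← extChartAt_source P.I] at this
    exact ℓ.contMDiff.comp_contMDiffOn (h1.comp hσ.contMDiffOn subset_rfl)
  have hopen : IsOpen (σ ⁻¹' φ.source) := (isOpen_extChartAt_source p).preimage hσ.continuous
  have := (dimH_mono hsub).trans (X.dimH_image_le hopen hsm)
  rw [Real.dimH_of_mem_nhds hW] at this
  exact_mod_cast this

/-! ### Initial submanifolds -/

/-- A map into a submanifold is smooth as soon as its composition with the inclusion is. -/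
theorem IsSubmanifold.contMDiff_of_comp {Q N : SmoothMfd.{u}} {X : SmoothMfd.{v}} {ι : N → Q.Cot}
    {s : Set Q.Cot} (h : IsSubmanifold Q N ι s) {f : X → N}
    (hf : ContMDiff X.I Q.CI ∞ (fun x => ι (f x))) : ContMDiff X.I N.I ∞ f := by
  intro x
  -- The field `initial` tests only maps from open subsets of Euclidean space, so f is read in a
  -- chart of X.
  have h1 : ContMDiffOn (𝓡 X.dim) N.I ∞ (f ∘ (extChartAt X.I x).symm) (extChartAt X.I x).target :=
    h.initial X.dim _ _ (isOpen_extChartAt_target x)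
      (hf.comp_contMDiffOn (contMDiffOn_extChartAt_symm x))
  have h2 : ContMDiffOn X.I 𝓘(ℝ, X.E) ∞ (extChartAt X.I x) (extChartAt X.I x).source := by
    have := contMDiffOn_extChartAt (I := X.I) (x := x) (n := ∞)
    rwa [← extChartAt_source X.I] at this
  have h3 := h1.comp h2 (fun y hy => (extChartAt X.I x).map_source hy)
  refine (h3.congr (f₁ := f) ?_).contMDiffAt (extChartAt_source_mem_nhds x)
  intro y hy
  exact congrArg f ((extChartAt X.I x).left_inv hy).symm

/-- A smooth map into `T*Q` with values in a submanifold lifts to a smooth map. -/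
theorem IsSubmanifold.exists_lift {Q N : SmoothMfd.{u}} {X : SmoothMfd.{v}} {ι : N → Q.Cot}
    {s : Set Q.Cot} (h : IsSubmanifold Q N ι s) {f : X → Q.Cot}
    (hf : ContMDiff X.I Q.CI ∞ f) (hs : ∀ x, f x ∈ s) :
    ∃ f' : X → N, ContMDiff X.I N.I ∞ f' ∧ ∀ x, ι (f' x) = f x := by
  have : ∀ x, ∃ n, ι n = f x := fun x => by
    have := hs x
    rwa [← h.range_eq] at this
  choose f' hf' using this
  refine ⟨f', h.contMDiff_of_comp ?_, hf'⟩
  simpa only [hf'] using hf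

/-! ### The geometry of the cotangent bundle -/

theorem contMDiff_proj (Q : SmoothMfd.{u}) : ContMDiff Q.CI Q.I ∞ Q.proj :=
  Bundle.contMDiff_proj _

theorem mdifferentiableAt_proj (Q : SmoothMfd.{u}) (z : Q.Cot) :
    MDifferentiableAt Q.CI Q.I Q.proj z :=
  (Q.contMDiff_proj z).mdifferentiableAt (by simp)

/-- The `dq`-component of a vertical vector vanishes. -/
theorem dqdp_fst_of_vertical (Q : SmoothMfd.{u}) (z : Q.Cot) (v : TangentSpace Q.CI z)
    (hv : mfderiv Q.CI Q.I Q.proj z v = 0) : (Q.dqdp z v).1 = 0 := by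
  have hd : MDifferentiableAt Q.CI 𝓘(ℝ, Q.E × (Q.E →L[ℝ] ℝ)) (extChartAt Q.CI z) z :=
    mdifferentiableAt_extChartAt (mem_chart_source _ z)
  have h1 : (fun y : Q.Cot => (extChartAt Q.CI z y).1) =
      fun y => extChartAt Q.I z.1 (Q.proj y) := rfl
  have hc : MDifferentiableAt Q.I 𝓘(ℝ, Q.E) (extChartAt Q.I z.1) (Q.proj z) :=
    mdifferentiableAt_extChartAt (mem_chart_source _ z.1)
  have h2 := congrArg (fun f => mfderiv Q.CI 𝓘(ℝ, Q.E) f z v) h1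
  have h3 : mfderiv Q.CI 𝓘(ℝ, Q.E) (fun y => extChartAt Q.I z.1 (Q.proj y)) z v = 0 := by
    have h := mfderiv_comp_apply (I' := Q.I) (v := v) z hc (Q.mdifferentiableAt_proj z)
    rw [hv, ContinuousLinearMap.map_zero] at h
    exact h
  have h4 : mfderiv Q.CI 𝓘(ℝ, Q.E) (fun y : Q.Cot => (extChartAt Q.CI z y).1) z v =
      (Q.dqdp z v).1 := by
    have h5 : HasMFDerivAt 𝓘(ℝ, Q.E × (Q.E →L[ℝ] ℝ)) 𝓘(ℝ, Q.E) Prod.fst (extChartAt Q.CI z z)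
        (ContinuousLinearMap.fst ℝ Q.E (Q.E →L[ℝ] ℝ)) :=
      (ContinuousLinearMap.fst ℝ Q.E (Q.E →L[ℝ] ℝ)).hasMFDerivAt
    have h6 := (h5.comp z hd.hasMFDerivAt).mfderiv
    exact congrArg (fun A => A v) h6
  rw [← h4]
  exact h2.trans h3

/-- The canonical form vanishes on pairs of vertical vectors. -/
theorem omega_of_vertical (Q : SmoothMfd.{u}) (z : Q.Cot) (v w : TangentSpace Q.CI z)
    (hv : mfderiv Q.CI Q.I Q.proj z v = 0) (hw : mfderiv Q.CI Q.I Q.proj z w = 0) :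
    Q.omega z v w = 0 := by
  simp [omega, Q.dqdp_fst_of_vertical z v hv, Q.dqdp_fst_of_vertical z w hw]

/-- Vertical lifts are vertical. -/
theorem mfderiv_proj_vertLift (Q : SmoothMfd.{u}) (x : Q) (a β : Q.CotFiber x) :
    mfderiv Q.CI Q.I Q.proj (⟨x, a⟩ : Q.Cot) (Q.vertLift x a β) = 0 := by
  have key : ∀ a b : Q.E →L[ℝ] ℝ, mfderiv Q.CI Q.I Q.proj (⟨x, a⟩ : Q.Cot)
      (mfderiv 𝓘(ℝ, Q.E →L[ℝ] ℝ) Q.CI (fun b : Q.E →L[ℝ] ℝ => (⟨x, b⟩ : Q.Cot)) a b) = 0 := by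
    intro a β
    by_cases h : MDifferentiableAt 𝓘(ℝ, Q.E →L[ℝ] ℝ) Q.CI
        (fun b : Q.E →L[ℝ] ℝ => (⟨x, b⟩ : Q.Cot)) a
    · have h1 := mfderiv_comp_apply (v := β) a (Q.mdifferentiableAt_proj ⟨x, a⟩) h
      have h2 : mfderiv 𝓘(ℝ, Q.E →L[ℝ] ℝ) Q.I
          (Q.proj ∘ (fun b : Q.E →L[ℝ] ℝ => (⟨x, b⟩ : Q.Cot))) a = 0 :=
        mfderiv_const (c := x)
      exact h1.symm.trans (congrArg (fun A => A β) h2)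
    -- The default value 0 of `mfderiv` spares a proof that the inclusion of the fibre is
    -- differentiable.
    · rw [mfderiv_zero_of_not_mdifferentiableAt h]
      exact ContinuousLinearMap.map_zero _
  exact key a β

theorem omega_sub_left (Q : SmoothMfd.{u}) (z : Q.Cot) (v v' w : TangentSpace Q.CI z) :
    Q.omega z (v - v') w = Q.omega z v w - Q.omega z v' w := by
  simp only [omega, ContinuousLinearMap.map_sub, Prod.fst_sub, Prod.snd_sub, sub_apply]
  ring

theorem omega_add_right (Q : SmoothMfd.{u}) (z : Q.Cot) (v w w' : TangentSpace Q.CI z) :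
    Q.omega z v (w + w') = Q.omega z v w + Q.omega z v w' := by
  simp only [omega, ContinuousLinearMap.map_add, Prod.fst_add, Prod.snd_add, add_apply]
  ring

theorem omega_smul_left (Q : SmoothMfd.{u}) (z : Q.Cot) (r : ℝ) (v w : TangentSpace Q.CI z) :
    Q.omega z (r • v) w = r * Q.omega z v w := by
  simp only [omega, ContinuousLinearMap.map_smul, Prod.smul_fst, Prod.smul_snd, smul_apply,
    smul_eq_mul]
  ring

theorem omega_swap (Q : SmoothMfd.{u}) (z : Q.Cot) (v w : TangentSpace Q.CI z) :
    Q.omega z w v = -Q.omega z v w := by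
  simp only [omega]
  ring

/-! ### The cotangent lifted action -/

section Action

variable {Q : SmoothMfd.{u}} {G : SmoothMfd.{v}} [Group G] [MulAction G Q]

theorem contMDiff_const_smul
    (h : ContMDiff (G.I.prod Q.I) Q.I ∞ (fun p : G × Q => p.1 • p.2)) (g : G) :
    ContMDiff Q.I Q.I ∞ (fun x : Q => g • x) :=
  h.comp (contMDiff_const.prodMk contMDiff_id)

theorem contMDiff_smul_const
    (h : ContMDiff (G.I.prod Q.I) Q.I ∞ (fun p : G × Q => p.1 • p.2)) (x : Q) :
    ContMDiff G.I Q.I ∞ (fun g : G => g • x) :=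
  h.comp (contMDiff_id.prodMk contMDiff_const)

/-- This replaces the `inverse` in `cotLift`, which is meaningful only for invertible maps, by a
derivative depending smoothly on the base point. -/
theorem inverse_mfderiv_smul
    (h : ContMDiff (G.I.prod Q.I) Q.I ∞ (fun p : G × Q => p.1 • p.2)) (g : G) (x : Q) :
    (mfderiv Q.I Q.I (fun y : Q => g • y) x).inverse =
      mfderiv Q.I Q.I (fun y : Q => g⁻¹ • y) (g • x) := by
  have hd : ∀ (g : G) (x : Q), MDifferentiableAt Q.I Q.I (fun y : Q => g • y) x :=
    fun g x => (contMDiff_const_smul h g x).mdifferentiableAt (by simp)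
  have key : ∀ (g : G) (x : Q), (mfderiv Q.I Q.I (fun y : Q => g⁻¹ • y) (g • x)).comp
      (mfderiv Q.I Q.I (fun y : Q => g • y) x) = ContinuousLinearMap.id ℝ _ := by
    intro g x
    have h1 := mfderiv_comp (I' := Q.I) x (hd g⁻¹ (g • x)) (hd g x)
    have h2 : (fun y : Q => g⁻¹ • y) ∘ (fun y : Q => g • y) = id := by
      funext y; simp
    rw [h2, mfderiv_id] at h1
    exact h1.symm
  refine ContinuousLinearMap.inverse_eq ?_ (key g x)
  have h1 := mfderiv_comp (I' := Q.I) (g • x) (hd g (g⁻¹ • g • x)) (hd g⁻¹ (g • x))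
  have h2 : (fun y : Q => g • y) ∘ (fun y : Q => g⁻¹ • y) = id := by
    funext y; simp
  rw [h2, mfderiv_id] at h1
  have h3 : ContinuousLinearMap.comp
      (show Q.E →L[ℝ] Q.E from mfderiv Q.I Q.I (fun y : Q => g • y) (g⁻¹ • g • x))
      (show Q.E →L[ℝ] Q.E from mfderiv Q.I Q.I (fun y : Q => g⁻¹ • y) (g • x)) =
      ContinuousLinearMap.id ℝ _ := h1.symm
  rw [inv_smul_smul] at h3
  exact h3

/-- In bundle coordinates the fibre component is the covector composed with the derivative of the
action of g⁻¹ at g • x, and both factors are smooth in the point of T*Q. -/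
theorem contMDiff_cotLift
    (h : ContMDiff (G.I.prod Q.I) Q.I ∞ (fun p : G × Q => p.1 • p.2)) (g : G) :
    ContMDiff Q.CI Q.CI ∞ (Q.cotLift g) := by
  have hsm := contMDiff_const_smul h g⁻¹
  intro z₀
  have hbase : ContMDiff Q.CI Q.I ∞ (fun z : Q.Cot => g • z.1) :=
    (contMDiff_const_smul h g).comp Q.contMDiff_proj
  refine (contMDiffAt_hom_bundle _).2 ⟨hbase z₀, ?_⟩
  have h1 := ((contMDiffAt_hom_bundle (IB := Q.I) (n := ∞) (fun z : Q.Cot => z) (x₀ := z₀)).1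
    contMDiffAt_id).2
  have h2 : ContMDiffAt Q.CI 𝓘(ℝ, Q.E →L[ℝ] Q.E) ∞
      (inTangentCoordinates Q.I Q.I (fun z : Q.Cot => g • z.1) (fun z : Q.Cot => g⁻¹ • g • z.1)
        (fun z => mfderiv Q.I Q.I (fun x : Q => g⁻¹ • x) (g • z.1)) z₀) z₀ :=
    ContMDiffAt.mfderiv (n := ∞) (fun _ : Q.Cot => fun x : Q => g⁻¹ • x) (fun z => g • z.1)
      (hsm.comp contMDiff_snd).contMDiffAt (hbase z₀) (by simp)
  refine (h1.clm_comp h2).congr_of_eventuallyEq ?_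
  have hU : Q.proj ⁻¹' (trivializationAt Q.E (TangentSpace Q.I) z₀.1).baseSet ∈ 𝓝 z₀ :=
    Q.contMDiff_proj.continuous.continuousAt.preimage_mem_nhds
      ((trivializationAt Q.E (TangentSpace Q.I) z₀.1).open_baseSet.mem_nhds
        (FiberBundle.mem_baseSet_trivializationAt' z₀.1))
  filter_upwards [hU] with z hz
  ext v
  simp only [inTangentCoordinates, ContinuousLinearMap.inCoordinates, inv_smul_smul,
    ContinuousLinearMap.comp_apply, cotLift, inverse_mfderiv_smul h]
  -- The base point g⁻¹ • g • x equals x only propositionally; a free variable y allows the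
  -- trivialization to be cancelled against its inverse.
  have key : ∀ (y : Q) (_ : y = z.1) (w : Q.E),
      (trivializationAt Q.E (TangentSpace Q.I) z₀.1).symmL ℝ z.1
        ((trivializationAt Q.E (TangentSpace Q.I) z₀.1).continuousLinearMapAt ℝ y w) = w := by
    rintro _ rfl w
    exact Trivialization.symmL_continuousLinearMapAt
      (trivializationAt Q.E (TangentSpace Q.I) z₀.1) (b := z.1) hz w
  have htriv : ∀ (a b : Q) (r : ℝ),
      (trivializationAt ℝ (Trivial Q ℝ) a).continuousLinearMapAt ℝ b r = r := by
    intro a b r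
    have h : (trivializationAt ℝ (Trivial Q ℝ) a).continuousLinearMapAt ℝ b =
        ContinuousLinearMap.id ℝ ℝ := Trivial.continuousLinearMapAt_trivialization ℝ Q ℝ b
    rw [h]
    rfl
  refine (htriv _ _ _).trans (Eq.trans ?_ (htriv _ _ _).symm)
  exact (congrArg (fun w : Q.E => z.snd w) (key _ (inv_smul_smul g z.1)
    (mfderiv Q.I Q.I (fun y : Q => g⁻¹ • y) (g • z.1)
      ((trivializationAt Q.E (TangentSpace Q.I) (g • z₀.1)).symmL ℝ (g • z.1) v)))).symm

end Action

/-! ### Linear algebra of a vertical Lagrangian -/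

section LinearAlgebra

variable {V E : Type*} [AddCommGroup V] [Module ℝ V] [AddCommGroup E] [Module ℝ E]
  {τ : V →ₗ[ℝ] E} {c : E →ₗ[ℝ] V} {D : Submodule ℝ E} {Ω : V →ₗ[ℝ] V →ₗ[ℝ] ℝ}

/-- A vertical vector which is orthogonal to the image of a horizontal lift of `D` vanishes. -/
theorem eq_zero_of_vertical_of_orthogonal (hτc : ∀ x, τ (c x) = x)
    (hiso : ∀ x y, τ x = 0 → τ y = 0 → Ω x y = 0)
    (hnd : ∀ x, τ x ∈ D → (∀ y, τ y ∈ D → Ω x y = 0) → x = 0)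
    {x : V} (hx : τ x = 0) (h : ∀ d ∈ D, Ω x (c d) = 0) : x = 0 := by
  refine hnd x (by rw [hx]; exact D.zero_mem) fun y hy => ?_
  -- The first summand is in the lift of D, where orthogonality is assumed; the second is vertical,
  -- and the vertical space is isotropic.
  have h1 : y = c (τ y) + (y - c (τ y)) := by abel
  rw [h1, map_add, h _ hy, hiso x _ hx (by rw [map_sub, hτc, sub_self]), add_zero]

/-- If the vertical space has dimension at least `dim D`, a vector over `D` which is orthogonal to
all vertical vectors is vertical. -/
theorem vertical_of_orthogonal [FiniteDimensional ℝ V] [FiniteDimensional ℝ E]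
    (hτc : ∀ x, τ (c x) = x)
    (hiso : ∀ x y, τ x = 0 → τ y = 0 → Ω x y = 0) (hskew : ∀ x y, Ω y x = -Ω x y)
    (hnd : ∀ x, τ x ∈ D → (∀ y, τ y ∈ D → Ω x y = 0) → x = 0)
    (hdim : Module.finrank ℝ V = Module.finrank ℝ E + Module.finrank ℝ D)
    {x : V} (hx : τ x ∈ D) (h : ∀ y, τ y = 0 → Ω x y = 0) : τ x = 0 := by
  -- The pairing of vertical vectors with D through the lift c is injective by the previous lemma,
  -- hence onto the dual of D by the dimension hypothesis. Since x - c (τ x) is vertical, a vector x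
  -- orthogonal to the vertical space has τ x killed by every functional on D.
  let Φ : LinearMap.ker τ →ₗ[ℝ] Module.Dual ℝ D :=
    ((LinearMap.lcomp ℝ ℝ (c ∘ₗ D.subtype)) ∘ₗ Ω) ∘ₗ (LinearMap.ker τ).subtype
  have hΦ : ∀ (y : LinearMap.ker τ) (d : D), Φ y d = Ω y (c d) := fun y d => rfl
  have hinj : Function.Injective Φ := by
    rw [injective_iff_map_eq_zero]
    intro y hy
    refine Subtype.ext (eq_zero_of_vertical_of_orthogonal hτc hiso hnd y.2 fun d hd => ?_)
    rw [← hΦ y ⟨d, hd⟩, hy, LinearMap.zero_apply]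
  have hker : Module.finrank ℝ (LinearMap.ker τ) = Module.finrank ℝ (Module.Dual ℝ D) := by
    have h1 := LinearMap.finrank_range_add_finrank_ker τ
    rw [LinearMap.range_eq_top.2 (fun x => ⟨c x, hτc x⟩), finrank_top] at h1
    rw [Subspace.dual_finrank_eq]
    omega
  have hsurj : Function.Surjective Φ :=
    (LinearMap.injective_iff_surjective_of_finrank_eq_finrank hker).1 hinj
  have key : (⟨τ x, hx⟩ : D) = 0 := by
    rw [← Module.forall_dual_apply_eq_zero_iff ℝ]
    intro f
    obtain ⟨y, rfl⟩ := hsurj f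
    have h2 : Ω y (x - c (τ x)) = 0 := hiso _ _ y.2 (by rw [map_sub, hτc, sub_self])
    have h3 : Ω y x = 0 := by rw [hskew x y, h _ y.2, neg_zero]
    rw [map_sub, h3, zero_sub, neg_eq_zero] at h2
    exact h2
  exact congrArg Subtype.val key

theorem finrank_comap_of_surjective [FiniteDimensional ℝ V] [FiniteDimensional ℝ E]
    (hτ : Function.Surjective τ) :
    Module.finrank ℝ (D.comap τ) + Module.finrank ℝ E =
      Module.finrank ℝ V + Module.finrank ℝ D := by
  have h1 := LinearMap.finrank_range_add_finrank_ker (D.mkQ ∘ₗ τ)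
  have h2 : LinearMap.range (D.mkQ ∘ₗ τ) = ⊤ :=
    LinearMap.range_eq_top.2 ((Submodule.mkQ_surjective D).comp hτ)
  have h3 : LinearMap.ker (D.mkQ ∘ₗ τ) = D.comap τ := by
    rw [LinearMap.ker_comp, Submodule.ker_mkQ]
  rw [h2, finrank_top, h3] at h1
  have h4 := D.finrank_quotient_add_finrank
  omega

end LinearAlgebra

section Systems

variable {Q : SmoothMfd.{u}} {G : SmoothMfd.{v}} [Group G] [LieGroup G.I ∞ G] [MulAction G Q]
  {S : NonholonomicRCH Q G} {T : DistributionalRCH S} {μ : G.LieDual}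

/-! ### The invariant one-form -/

/-- If `μ` is the momentum of an invariant one-form, its coadjoint orbit is a point. -/
theorem NonholonomicRCH.J_eq_of_mem_orbitLevel {γ : ∀ x : Q, Q.CotFiber x}
    (hγ_inv : ∀ (g : G) (q : Q), Q.cotLift g (Q.sec γ q) = Q.sec γ (g • q))
    (hγ_J : ∀ q, S.J (Q.sec γ q) = μ) {z : Q.Cot} (hz : z ∈ S.orbitLevel μ) : S.J z = μ := by
  obtain ⟨g, hg⟩ := hz
  -- Along γ the momentum is μ both before and after acting by g, so g fixes μ.
  have h := S.momentum.equivariant g (Q.sec γ z.1)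
  rw [hγ_inv, hγ_J, hγ_J] at h
  rw [hg, ← h]

theorem NonholonomicRCH.cotLift_mem_orbitLevel {γ : ∀ x : Q, Q.CotFiber x}
    (hγ_inv : ∀ (g : G) (q : Q), Q.cotLift g (Q.sec γ q) = Q.sec γ (g • q))
    (hγ_J : ∀ q, S.J (Q.sec γ q) = μ) (g : G) {z : Q.Cot} (hz : z ∈ S.orbitLevel μ) :
    Q.cotLift g z ∈ S.orbitLevel μ :=
  ⟨g, by rw [S.momentum.equivariant, S.J_eq_of_mem_orbitLevel hγ_inv hγ_J hz]⟩

/-- The action is infinitesimally free along an invariant one-form whose momentum is a regular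
value. -/
theorem NonholonomicRCH.eq_zero_of_mfderiv_sec_smul_eq_zero {γ : ∀ x : Q, Q.CotFiber x}
    (hγ_smooth : ContMDiff Q.I Q.CI ∞ (Q.sec γ))
    (hγ_inv : ∀ (g : G) (q : Q), Q.cotLift g (Q.sec γ q) = Q.sec γ (g • q))
    (hγ_J : ∀ q, S.J (Q.sec γ q) = μ)
    (hreg : ∀ z, S.J z = μ → Function.Surjective (mvfderiv Q.CI S.J z))
    (q : Q) (ξ : G.LieAlg)
    (hξ : mfderiv Q.I Q.CI (Q.sec γ) ((1 : G) • q)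
      (mfderiv G.I Q.I (fun g : G => g • q) 1 ξ) = 0) : ξ = 0 := by
  -- By invariance the orbit of γ(q) is the image under γ of the orbit of q, so the hypothesis says
  -- that the generator of ξ vanishes at γ(q).
  have hgen : Q.cotGen ξ (Q.sec γ q) = 0 := by
    have h1 : (fun g : G => Q.cotLift g (Q.sec γ q)) = Q.sec γ ∘ (fun g : G => g • q) :=
      funext fun g => hγ_inv g q
    have h2 := mfderiv_comp_apply (I' := Q.I) (v := ξ) (1 : G)
      ((hγ_smooth.mdifferentiable (by simp)) ((1 : G) • q))
      (((contMDiff_smul_const S.smooth_action q).mdifferentiable (by simp)) 1)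
    rw [hξ] at h2
    have h3 := congrArg (fun f => (mfderiv G.I Q.CI f 1 ξ : Q.E × (Q.E →L[ℝ] ℝ))) h1
    exact h3.trans h2
  set z := Q.cotLift (1 : G) (Q.sec γ q) with hz
  have hJz : S.J z = μ := by rw [hz, hγ_inv, hγ_J]
  have hJd : MDifferentiableAt Q.CI 𝓘(ℝ, G.LieDual) S.J z :=
    (S.momentum.smooth.mdifferentiable (by simp)) z
  -- A vanishing generator gives d⟨J, ξ⟩ = 0, while dJ is onto the dual of the Lie algebra at a
  -- regular value.
  have key : ∀ ν : G.LieDual, ν ξ = 0 := by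
    intro ν
    obtain ⟨w, rfl⟩ := hreg z hJz ν
    have h1 := S.momentum.momentum ξ (Q.sec γ q) w
    rw [hgen] at h1
    have h2 : mvfderiv Q.CI (fun y => S.J y ξ) z w = mvfderiv Q.CI S.J z w ξ :=
      mvfderiv_comp_apply (g := fun ν : G.LieDual => ν ξ) z
        (ContinuousLinearMap.apply ℝ ℝ ξ).differentiableAt.mdifferentiableAt hJd w |>.trans
        (by
          have h3 : mvfderiv 𝓘(ℝ, G.LieDual) (fun ν : G.LieDual => ν ξ) (S.J z) =
              ContinuousLinearMap.apply ℝ ℝ ξ := by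
            have := ((ContinuousLinearMap.apply ℝ ℝ ξ).hasMFDerivAt (x := S.J z)).mfderiv
            exact this
          rw [h3]; rfl)
    rw [← h2, ← h1]
    have h4 : Q.omega z 0 w = 0 := by
      have := Q.omega_sub_left z 0 0 w
      rw [sub_zero] at this
      linarith
    exact h4
  by_contra hne
  obtain ⟨ν, hν⟩ := SeparatingDual.exists_ne_zero (R := ℝ) hne
  exact hν (key ν)

/-! ### The reduced space -/

/-- Along the level set of a momentum with trivial coadjoint orbit, the reduced form pulls back to
the canonical form. -/
theorem OrbitReduction.omega_eq_ωO (B : OrbitReduction S T μ)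
    (hJ : ∀ z ∈ S.orbitLevel μ, S.J z = μ) (p : B.P) (v w : TangentSpace B.P.I p) :
    Q.omega (B.iP p) (mfderiv B.P.I Q.CI B.iP p v) (mfderiv B.P.I Q.CI B.iP p w) =
      B.ωO (B.πP p) (mfderiv B.P.I B.R.I B.πP p v) (mfderiv B.P.I B.R.I B.πP p w) := by
  have hd : ∀ v, mvfderiv Q.CI S.J (B.iP p) (mfderiv B.P.I Q.CI B.iP p v) =
      coadGen G 0 (S.J (B.iP p)) := by
    intro v
    have h1 : S.J ∘ B.iP = fun _ => μ := funext fun p =>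
      hJ _ (B.submanifold_P.range_eq ▸ Set.mem_range_self p)
    have h2 : mvfderiv B.P.I (S.J ∘ B.iP) p v =
        mvfderiv Q.CI S.J (B.iP p) (mfderiv B.P.I Q.CI B.iP p v) :=
      mfderiv_comp_apply (I' := Q.CI) (v := v) p ((S.momentum.smooth.mdifferentiable (by simp)) (B.iP p))
      ((B.submanifold_P.smooth.mdifferentiable (by simp)) p)
    have h3 : mvfderiv B.P.I (S.J ∘ B.iP) p = 0 := by
      rw [h1]; exact mvfderiv_const μ
    have h4 : coadGen G 0 (S.J (B.iP p)) = 0 := ContinuousLinearMap.map_zero _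
    rw [h4, ← h2, h3]
    rfl
  -- J is constant on J⁻¹(O_μ), so ξ = η = 0 represents both tangent vectors and the orbit term is a
  -- bracket of zeros.
  have h := B.ωO_eq p v w 0 0 (hd v) (hd w)
  have : LieGroup G.I (minSmoothness ℝ 3) G := by
    rw [minSmoothness_of_isRCLikeNormedField]
    exact inferInstance
  have hb : lieBr G 0 0 = 0 := lie_zero (L := GroupLieAlgebra G.I G) (M := GroupLieAlgebra G.I G) 0
  rw [h, hb, ContinuousLinearMap.map_zero, add_zero]

/-- Along an invariant one-form, the kernel of the projection to the reduced space consists of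
vectors tangent to the orbits. -/
theorem OrbitReduction.exists_of_mfderiv_πP_eq_zero (B : OrbitReduction S T μ)
    {γ : ∀ x : Q, Q.CotFiber x} (hγ_smooth : ContMDiff Q.I Q.CI ∞ (Q.sec γ))
    (hγ_inv : ∀ (g : G) (q : Q), Q.cotLift g (Q.sec γ q) = Q.sec γ (g • q))
    (hγ_J : ∀ q, S.J (Q.sec γ q) = μ)
    {γP : Q → B.P} (hγP : ContMDiff Q.I B.P.I ∞ γP) (hiγ : ∀ q, B.iP (γP q) = Q.sec γ q)
    (q : Q) (v : TangentSpace B.P.I (γP q)) (hv : mfderiv B.P.I B.R.I B.πP (γP q) v = 0) :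
    ∃ η : TangentSpace Q.I q, v = mfderiv Q.I B.P.I γP q η ∧
      ∀ (X : SmoothMfd.{u}) (f : Q → X), MDifferentiable Q.I X.I f →
        (∀ (g : G), f (g • q) = f q) → mfderiv Q.I X.I f q η = 0 := by
  have hsm := contMDiff_smul_const S.smooth_action q
  have hsmd : MDifferentiableAt G.I Q.I (fun g : G => g • q) 1 := (hsm.mdifferentiable (by simp)) 1
  have hγPd := hγP.mdifferentiable (by simp)
  let A : G.E →L[ℝ] Q.E := mfderiv G.I Q.I (fun g : G => g • q) 1
  -- derivative of a function along the orbit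
  have hcomp : ∀ (X : SmoothMfd.{u}) (f : Q → X), MDifferentiable Q.I X.I f → ∀ ξ : G.E,
      (mfderiv G.I X.I (fun g : G => f (g • q)) 1 ξ : X.E) = mfderiv Q.I X.I f q (A ξ) := by
    intro X f hf ξ
    have h1 : (mfderiv G.I X.I (fun g : G => f (g • q)) 1 ξ : X.E) =
        (show Q.E →L[ℝ] X.E from mfderiv Q.I X.I f ((1 : G) • q)) (A ξ) :=
      mfderiv_comp_apply (I' := Q.I) (v := ξ) (1 : G) (hf _) hsmd
    rw [one_smul] at h1
    exact h1
  have hconst : ∀ (X : SmoothMfd.{u}) (f : Q → X), MDifferentiable Q.I X.I f →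
      (∀ (g : G), f (g • q) = f q) → ∀ ξ : G.E, mfderiv Q.I X.I f q (A ξ) = 0 := by
    intro X f hf hfg ξ
    rw [← hcomp X f hf ξ]
    have h1 : (fun g : G => f (g • q)) = fun _ => f q := funext hfg
    have h2 : mfderiv G.I X.I (fun g : G => f (g • q)) 1 = 0 := by
      rw [h1]; exact mfderiv_const
    rw [h2]; rfl
  let C : G.E →L[ℝ] B.P.E := (show Q.E →L[ℝ] B.P.E from mfderiv Q.I B.P.I γP q).comp A
  let K : B.P.E →L[ℝ] B.R.E := mfderiv B.P.I B.R.I B.πP (γP q)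
  -- The fibre of the projection through γ(q) is a single orbit, hence the image of G.
  have hle : Module.finrank ℝ K.ker ≤ G.dim := by
    refine finrank_ker_le_of_fiber_subset_range B.submersion_P.smooth
      (B.submersion_P.submersion (γP q)) (σ := fun g : G => γP (g • q)) (hγP.comp hsm) ?_
    intro p' hp'
    obtain ⟨g, hg⟩ := (B.orbit_P _ _).1 hp'.symm
    refine ⟨g, B.submanifold_P.injective ?_⟩
    rw [← hg, hiγ, hiγ, hγ_inv]
  have hCK : ∀ ξ, K (C ξ) = 0 := by
    intro ξ
    have h1 := hconst B.R (B.πP ∘ γP)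
      ((B.submersion_P.smooth.mdifferentiable (by simp)).comp hγPd) (fun g => by
        refine ((B.orbit_P _ _).2 ⟨g, ?_⟩).symm
        rw [hiγ, hiγ, hγ_inv]) ξ
    have h2 := mfderiv_comp_apply (I' := B.P.I) (v := A ξ) q
      ((B.submersion_P.smooth.mdifferentiable (by simp)) (γP q)) (hγPd q)
    exact h2.symm.trans h1
  have hCinj : Function.Injective C := by
    rw [injective_iff_map_eq_zero]
    intro ξ hξ
    refine S.eq_zero_of_mfderiv_sec_smul_eq_zero hγ_smooth hγ_inv hγ_J B.regular q ξ ?_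
    have h1 : Q.sec γ = B.iP ∘ γP := funext fun q => (hiγ q).symm
    have h2 := mfderiv_comp_apply (I' := B.P.I) (v := A ξ) q
      ((B.submanifold_P.smooth.mdifferentiable (by simp)) (γP q)) (hγPd q)
    have h3 : (mfderiv B.P.I Q.CI B.iP (γP q)) (C ξ) = 0 := by
      rw [hξ]; exact ContinuousLinearMap.map_zero _
    have h4 : (show Q.E →L[ℝ] Q.E × (Q.E →L[ℝ] ℝ) from
        mfderiv Q.I Q.CI (Q.sec γ) q) (A ξ) = 0 := by
      rw [h1]; exact h2.trans h3
    have h5 : (show Q.E →L[ℝ] Q.E × (Q.E →L[ℝ] ℝ) from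
        mfderiv Q.I Q.CI (Q.sec γ) ((1 : G) • q)) (A ξ) = 0 := by
      rw [one_smul]; exact h4
    exact h5
  -- The orbit directions lie in the kernel and already have dimension dim G, by injectivity of C,
  -- so they exhaust it.
  have hrange : C.range = K.ker := by
    refine Submodule.eq_of_le_of_finrank_le ?_ ?_
    · rintro _ ⟨ξ, rfl⟩
      exact hCK ξ
    · rw [LinearMap.finrank_range_of_inj hCinj]
      simpa using hle
  obtain ⟨ξ, hξ⟩ : v ∈ C.range := by rw [hrange]; exact hv
  exact ⟨A ξ, hξ.symm, fun X f hf hfg => hconst X f hf hfg ξ⟩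

/-- The constraint distribution as a subset of `TQ`. -/
def NonholonomicRCH.constraintBundle (S : NonholonomicRCH Q G) : Set (TangentBundle Q.I Q) :=
  {a | a.2 ∈ S.D a.1}

/-- Membership in F depends only on the projected vector in TQ. Expressed through `tangentMap`, it
passes along composites without casts between tangent spaces. -/
theorem NonholonomicRCH.mfderiv_mem_distF_iff (S : NonholonomicRCH Q G) {X : SmoothMfd.{u}}
    {f : X → Q.Cot} (hf : ContMDiff X.I Q.CI ∞ f) (x : X) (v : TangentSpace X.I x) :
    mfderiv X.I Q.CI f x v ∈ S.distF (f x) ↔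
      tangentMap X.I Q.I (Q.proj ∘ f) ⟨x, v⟩ ∈ S.constraintBundle := by
  rw [tangentMap_comp_at (I' := Q.CI) _ (Q.mdifferentiableAt_proj _)
    ((hf.mdifferentiable (by simp)) x)]
  rfl

theorem NonholonomicRCH.tangentMap_smul_mem (S : NonholonomicRCH Q G) (g : G)
    {a : TangentBundle Q.I Q} (ha : a ∈ S.constraintBundle) :
    tangentMap Q.I Q.I (fun x : Q => g • x) a ∈ S.constraintBundle :=
  S.invariant_D g a.1 a.2 ha

theorem tangentBundle_mk_injective {X : SmoothMfd.{u}} {x : X} {v w : TangentSpace X.I x}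
    (h : (⟨x, v⟩ : TangentBundle X.I X) = ⟨x, w⟩) : v = w :=
  eq_of_heq (TotalSpace.mk.inj h).2

theorem tangentMap_comp_of_contMDiff {X Y Z : SmoothMfd.{u}} {f : X → Y} {g : Y → Z}
    (hg : ContMDiff Y.I Z.I ∞ g) (hf : ContMDiff X.I Y.I ∞ f) (a : TangentBundle X.I X) :
    tangentMap X.I Z.I (g ∘ f) a = tangentMap Y.I Z.I g (tangentMap X.I Y.I f a) :=
  tangentMap_comp_at a ((hg.mdifferentiable (by simp)) _) ((hf.mdifferentiable (by simp)) _)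

/-! ### Lifting the reduced constraint distribution -/

namespace OrbitReduction

variable (B : OrbitReduction S T μ)

theorem iMO_comp_πN {k : B.N → B.P} (hik : ∀ n, B.iP (k n) = B.iN n) :
    B.iMO ∘ B.πN = B.πP ∘ k :=
  funext fun n => B.iMO_eq n (k n) (hik n).symm

/-- The projection to `M_{O_μ}` maps `F ∩ T(M ∩ J⁻¹(O_μ))` to `K_{O_μ}`. -/
theorem mfderiv_πN_mem_KO {k : B.N → B.P} (hk : ContMDiff B.N.I B.P.I ∞ k)
    (hik : ∀ n, B.iP (k n) = B.iN n) (n : B.N) (v : TangentSpace B.N.I n)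
    (hv : mfderiv B.N.I Q.CI B.iN n v ∈ S.distF (B.iN n)) :
    mfderiv B.N.I B.MO.I B.πN n v ∈ B.KO (B.πN n) := by
  refine ⟨tangentMap B.N.I B.P.I k ⟨n, v⟩, ?_, ?_⟩
  · rw [Set.mem_ofPred_eq, S.mfderiv_mem_distF_iff B.submanifold_P.smooth]
    have h1 : Q.proj ∘ B.iN = (Q.proj ∘ B.iP) ∘ k := funext fun n => by simp [hik]
    rw [S.mfderiv_mem_distF_iff B.submanifold_N.smooth, h1,
      tangentMap_comp_of_contMDiff (Q.contMDiff_proj.comp B.submanifold_P.smooth) hk] at hv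
    exact hv
  · rw [← tangentMap_comp_of_contMDiff B.submersion_P.smooth hk, ← B.iMO_comp_πN hik,
      tangentMap_comp_of_contMDiff B.smooth_iMO B.submersion_N.smooth]
    rfl

/-- Along an invariant one-form, every vector of `K_{O_μ}` is the projection of a vector of
`F ∩ T(M ∩ J⁻¹(O_μ))`. -/
theorem exists_of_mem_KO
    {γ : ∀ x : Q, Q.CotFiber x} (hγ_smooth : ContMDiff Q.I Q.CI ∞ (Q.sec γ))
    (hγ_inv : ∀ (g : G) (q : Q), Q.cotLift g (Q.sec γ q) = Q.sec γ (g • q))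
    (hγ_J : ∀ q, S.J (Q.sec γ q) = μ)
    {k : B.N → B.P} (hk : ContMDiff B.N.I B.P.I ∞ k) (hik : ∀ n, B.iP (k n) = B.iN n)
    {γN : Q → B.N} (hγN : ContMDiff Q.I B.N.I ∞ γN) (hiγ : ∀ q, B.iN (γN q) = Q.sec γ q)
    (q : Q) (w : TangentSpace B.MO.I (B.πN (γN q))) (hw : w ∈ B.KO (B.πN (γN q))) :
    ∃ v : TangentSpace B.N.I (γN q),
      mfderiv B.N.I Q.CI B.iN (γN q) v ∈ S.distF (B.iN (γN q)) ∧
        mfderiv B.N.I B.MO.I B.πN (γN q) v = w := by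
  obtain ⟨b, hb, hbw⟩ := hw
  obtain ⟨p', v''⟩ := b
  -- transport to the given point of the orbit
  have hbase : B.πP p' = B.πP (k (γN q)) := by
    have h1 : B.πP p' = B.iMO (B.πN (γN q)) := congrArg TotalSpace.proj hbw
    rw [h1]
    exact congrFun (B.iMO_comp_πN hik) (γN q)
  obtain ⟨g, hg⟩ := (B.orbit_P _ _).1 hbase
  have hPmem : ∀ p, B.iP p ∈ S.orbitLevel μ := fun p =>
    B.submanifold_P.range_eq ▸ Set.mem_range_self p
  obtain ⟨Φ, hΦ, hiΦ⟩ := B.submanifold_P.exists_lift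
    ((contMDiff_cotLift S.smooth_action g).comp B.submanifold_P.smooth)
    (fun p => S.cotLift_mem_orbitLevel hγ_inv hγ_J g (hPmem p))
  have hΦp : Φ p' = k (γN q) := B.submanifold_P.injective ((hiΦ p').trans hg)
  have hπΦ : B.πP ∘ Φ = B.πP := funext fun p => ((B.orbit_P _ _).2 ⟨g, (hiΦ p).symm⟩).symm
  obtain ⟨v₁, hv₁⟩ : ∃ v₁ : TangentSpace B.P.I (k (γN q)),
      (⟨k (γN q), v₁⟩ : TangentBundle B.P.I B.P) = tangentMap B.P.I B.P.I Φ ⟨p', v''⟩ := by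
    have : ∀ a : TangentBundle B.P.I B.P, a.1 = k (γN q) →
        ∃ v₁ : TangentSpace B.P.I (k (γN q)), (⟨k (γN q), v₁⟩ : TangentBundle B.P.I B.P) = a := by
      rintro ⟨a, v⟩ rfl
      exact ⟨v, rfl⟩
    exact this _ hΦp
  have hv₁F : tangentMap B.P.I Q.I (Q.proj ∘ B.iP) ⟨k (γN q), v₁⟩ ∈ S.constraintBundle := by
    rw [Set.mem_ofPred_eq, S.mfderiv_mem_distF_iff B.submanifold_P.smooth] at hb
    have hPs := Q.contMDiff_proj.comp B.submanifold_P.smooth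
    have h1 : (Q.proj ∘ B.iP) ∘ Φ = (fun x : Q => g • x) ∘ (Q.proj ∘ B.iP) :=
      funext fun p => congrArg Q.proj (hiΦ p)
    rw [hv₁, ← tangentMap_comp_of_contMDiff hPs hΦ, h1,
      tangentMap_comp_of_contMDiff (contMDiff_const_smul S.smooth_action g) hPs]
    exact S.tangentMap_smul_mem g hb
  -- This lift of w is tangent to N but need not lie in F, whereas v₁ lies in F but is not yet known
  -- to be tangent to N.
  obtain ⟨n', hn'⟩ := B.submersion_N.submersion (γN q) w
  have hn'w : tangentMap B.N.I B.MO.I B.πN ⟨γN q, n'⟩ = ⟨B.πN (γN q), w⟩ := by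
    rw [← hn']; rfl
  have hker : mfderiv B.P.I B.R.I B.πP (k (γN q)) (v₁ - mfderiv B.N.I B.P.I k (γN q) n') = 0 := by
    have h1 : tangentMap B.P.I B.R.I B.πP ⟨k (γN q), v₁⟩ =
        tangentMap B.P.I B.R.I B.πP (tangentMap B.N.I B.P.I k ⟨γN q, n'⟩) := by
      rw [hv₁, ← tangentMap_comp_of_contMDiff B.submersion_P.smooth hΦ, hπΦ, hbw, ← hn'w,
        ← tangentMap_comp_of_contMDiff B.smooth_iMO B.submersion_N.smooth, B.iMO_comp_πN hik,
        ← tangentMap_comp_of_contMDiff B.submersion_P.smooth hk]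
    have h2 := tangentBundle_mk_injective h1
    rw [ContinuousLinearMap.map_sub, h2]
    exact sub_self _
  -- The two lifts differ by an orbit direction, the image of some η under γ. As γ takes values in
  -- N, this makes v₁ tangent to N; and η is invisible in M_{O_μ}, where γ is constant along orbits.
  obtain ⟨η, hη, hηf⟩ := B.exists_of_mfderiv_πP_eq_zero hγ_smooth hγ_inv hγ_J (γP := k ∘ γN)
    (hk.comp hγN) (fun q => (hik _).trans (hiγ q)) q _ hker
  have hη' : v₁ = mfderiv B.N.I B.P.I k (γN q) (n' + mfderiv Q.I B.N.I γN q η) := by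
    have h1 := mfderiv_comp_apply (I' := B.N.I) (v := η) q
      ((hk.mdifferentiable (by simp)) (γN q)) ((hγN.mdifferentiable (by simp)) q)
    rw [ContinuousLinearMap.map_add, ← h1]
    exact sub_eq_iff_eq_add'.1 hη
  refine ⟨n' + mfderiv Q.I B.N.I γN q η, ?_, ?_⟩
  · have h1 : Q.proj ∘ B.iN = (Q.proj ∘ B.iP) ∘ k := funext fun n => by simp [hik]
    rw [S.mfderiv_mem_distF_iff B.submanifold_N.smooth, h1,
      tangentMap_comp_of_contMDiff (Q.contMDiff_proj.comp B.submanifold_P.smooth) hk]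
    rw [hη'] at hv₁F
    exact hv₁F
  · have h1 := mfderiv_comp_apply (I' := B.N.I) (v := η) q
      ((B.submersion_N.smooth.mdifferentiable (by simp)) (γN q))
      ((hγN.mdifferentiable (by simp)) q)
    have h2 := hηf B.MO (B.πN ∘ γN)
      ((B.submersion_N.smooth.comp hγN).mdifferentiable (by simp)) (fun g =>
        ((B.orbit_N _ _).2 ⟨g, by rw [hiγ, hiγ, hγ_inv]⟩).symm)
    rw [ContinuousLinearMap.map_add, hn', ← h1, h2]
    exact add_zero _

/-- The form on `M_{O_μ}` pulls back to the restriction of the canonical form. -/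
theorem ωMO_mfderiv_πN (hJ : ∀ z ∈ S.orbitLevel μ, S.J z = μ)
    {k : B.N → B.P} (hk : ContMDiff B.N.I B.P.I ∞ k) (hik : ∀ n, B.iP (k n) = B.iN n)
    {j : B.N → T.M} (hj : ContMDiff B.N.I T.M.I ∞ j) (hij : ∀ n, T.iM (j n) = B.iN n)
    (n : B.N) (v w : TangentSpace B.N.I n) :
    B.ωMO (B.πN n) (mfderiv B.N.I B.MO.I B.πN n v) (mfderiv B.N.I B.MO.I B.πN n w) =
      Q.omega (T.iM (j n)) (mfderiv T.M.I Q.CI T.iM (j n) (mfderiv B.N.I T.M.I j n v))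
        (mfderiv T.M.I Q.CI T.iM (j n) (mfderiv B.N.I T.M.I j n w)) := by
  have hR : ∀ f f' : B.N → B.R, f = f' →
      B.ωO (f n) (mfderiv B.N.I B.R.I f n v) (mfderiv B.N.I B.R.I f n w) =
        B.ωO (f' n) (mfderiv B.N.I B.R.I f' n v) (mfderiv B.N.I B.R.I f' n w) := by
    rintro f _ rfl; rfl
  have hC : ∀ f f' : B.N → Q.Cot, f = f' →
      Q.omega (f n) (mfderiv B.N.I Q.CI f n v) (mfderiv B.N.I Q.CI f n w) =
        Q.omega (f' n) (mfderiv B.N.I Q.CI f' n v) (mfderiv B.N.I Q.CI f' n w) := by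
    rintro f _ rfl; rfl
  have h1 := hR _ _ (B.iMO_comp_πN hik)
  have h2 := hC (B.iP ∘ k) (T.iM ∘ j) (funext fun n => (hik n).trans (hij n).symm)
  have hkd := (hk.mdifferentiable (by simp)) n
  have hjd := (hj.mdifferentiable (by simp)) n
  have hNd := (B.submersion_N.smooth.mdifferentiable (by simp)) n
  rw [mfderiv_comp n ((B.smooth_iMO.mdifferentiable (by simp)) (B.πN n)) hNd,
    mfderiv_comp n ((B.submersion_P.smooth.mdifferentiable (by simp)) (k n)) hkd] at h1
  rw [mfderiv_comp n ((B.submanifold_P.smooth.mdifferentiable (by simp)) (k n)) hkd,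
    mfderiv_comp n ((T.submanifold.smooth.mdifferentiable (by simp)) (j n)) hjd] at h2
  exact h1.trans ((B.omega_eq_ωO hJ (k n) _ _).symm.trans h2)

end OrbitReduction

/-! ### The reduced dynamics -/

theorem mfderiv_iM_mem_distF_of_mem {X : SmoothMfd.{u}} {f : X → Q.Cot} {j : X → T.M}
    (hf : ContMDiff X.I Q.CI ∞ f)
    (hj : ContMDiff X.I T.M.I ∞ j) (hij : ∀ x, T.iM (j x) = f x) (x : X)
    {v : TangentSpace X.I x} (hv : mfderiv X.I Q.CI f x v ∈ S.distF (f x)) :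
    mfderiv T.M.I Q.CI T.iM (j x) (mfderiv X.I T.M.I j x v) ∈ S.distF (T.iM (j x)) := by
  have h1 : Q.proj ∘ f = (Q.proj ∘ T.iM) ∘ j := funext fun x => by simp [hij]
  rw [S.mfderiv_mem_distF_iff hf, h1,
    tangentMap_comp_of_contMDiff (Q.contMDiff_proj.comp T.submanifold.smooth) hj] at hv
  rw [S.mfderiv_mem_distF_iff T.submanifold.smooth]
  exact hv

/-- The reduced Hamiltonian equation along an invariant one-form, pulled back to
`M ∩ J⁻¹(O_μ)`. -/
theorem ReducedDistributionalRCH.eq_XKO_iff (B : ReducedDistributionalRCH S T μ)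
    {γ : ∀ x : Q, Q.CotFiber x} (hγ_smooth : ContMDiff Q.I Q.CI ∞ (Q.sec γ))
    (hγ_inv : ∀ (g : G) (q : Q), Q.cotLift g (Q.sec γ q) = Q.sec γ (g • q))
    (hγ_J : ∀ q, S.J (Q.sec γ q) = μ)
    {k : B.N → B.P} (hk : ContMDiff B.N.I B.P.I ∞ k) (hik : ∀ n, B.iP (k n) = B.iN n)
    {j : B.N → T.M} (hj : ContMDiff B.N.I T.M.I ∞ j) (hij : ∀ n, T.iM (j n) = B.iN n)
    {γN : Q → B.N} (hγN : ContMDiff Q.I B.N.I ∞ γN) (hiγ : ∀ q, B.iN (γN q) = Q.sec γ q)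
    (q : Q) (a : TangentSpace B.N.I (γN q))
    (ha : mfderiv B.N.I B.MO.I B.πN (γN q) a ∈ B.KO (B.πN (γN q))) :
    mfderiv B.N.I B.MO.I B.πN (γN q) a = B.XKO (B.πN (γN q)) ↔
      ∀ v : TangentSpace B.N.I (γN q),
        mfderiv B.N.I Q.CI B.iN (γN q) v ∈ S.distF (B.iN (γN q)) →
        Q.omega (T.iM (j (γN q)))
          (mfderiv T.M.I Q.CI T.iM (j (γN q)) (mfderiv B.N.I T.M.I j (γN q) a))
          (mfderiv T.M.I Q.CI T.iM (j (γN q)) (mfderiv B.N.I T.M.I j (γN q) v)) =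
        Q.omega (T.iM (j (γN q))) (mfderiv T.M.I Q.CI T.iM (j (γN q)) (T.XK (j (γN q))))
          (mfderiv T.M.I Q.CI T.iM (j (γN q)) (mfderiv B.N.I T.M.I j (γN q) v)) := by
  have hJ : ∀ z ∈ S.orbitLevel μ, S.J z = μ := fun z hz =>
    S.J_eq_of_mem_orbitLevel hγ_inv hγ_J hz
  have hlift := fun w hw => B.exists_of_mem_KO hγ_smooth hγ_inv hγ_J hk hik hγN hiγ q w hw
  revert a
  generalize γN q = n at hlift ⊢
  intro a ha
  -- both Hamiltonian equations have the same right hand side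
  have hH : ∀ v : TangentSpace B.N.I n, mfderiv B.N.I Q.CI B.iN n v ∈ S.distF (B.iN n) →
      Q.omega (T.iM (j n)) (mfderiv T.M.I Q.CI T.iM (j n) (T.XK (j n)))
          (mfderiv T.M.I Q.CI T.iM (j n) (mfderiv B.N.I T.M.I j n v)) =
        B.ωMO (B.πN n) (B.XKO (B.πN n)) (mfderiv B.N.I B.MO.I B.πN n v) := by
    intro v hv
    rw [T.XK_eq _ _ (mfderiv_iM_mem_distF_of_mem B.submanifold_N.smooth hj hij n hv),
      B.XKO_eq _ _ (B.mfderiv_πN_mem_KO hk hik n v hv)]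
    have h1 := mvfderiv_comp_apply (g := fun m => S.H (T.iM m)) n
      (((S.smooth_H.comp T.submanifold.smooth).mdifferentiable (by simp)) (j n))
      ((hj.mdifferentiable (by simp)) n) v
    have h2 := mvfderiv_comp_apply (g := fun y => B.h (B.iMO y)) n
      (((B.smooth_h.comp B.smooth_iMO).mdifferentiable (by simp)) (B.πN n))
      ((B.submersion_N.smooth.mdifferentiable (by simp)) n) v
    rw [← h1, ← h2]
    have h3 : (fun m => S.H (T.iM m)) ∘ j = (fun y => B.h (B.iMO y)) ∘ B.πN := by
      funext n
      have h4 : B.iMO (B.πN n) = B.πP (k n) := B.iMO_eq n (k n) (hik n).symm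
      simp only [Function.comp_apply, hij, h4, B.h_eq, hik]
    rw [h3]
  have hω := B.ωMO_mfderiv_πN hJ hk hik hj hij n
  constructor
  · intro h v hv
    rw [hH v hv, ← h, hω]
  · intro h
    -- `KO` is only a set of vectors; lifting both sides to the subspace F ∩ TN shows that their
    -- difference belongs to it, as nondegeneracy requires.
    obtain ⟨a₁, ha₁, ha₁'⟩ := hlift _ ha
    obtain ⟨x, hx, hx'⟩ := hlift _ (B.XKO_mem (B.πN n))
    have hsub : mfderiv B.N.I B.MO.I B.πN n a - B.XKO (B.πN n) =
        mfderiv B.N.I B.MO.I B.πN n (a₁ - x) := by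
      rw [ContinuousLinearMap.map_sub, ha₁', hx']
    refine sub_eq_zero.1 (B.nondegenerate (B.πN n) _ ?_ ?_)
    · rw [hsub]
      refine B.mfderiv_πN_mem_KO hk hik n _ ?_
      rw [ContinuousLinearMap.map_sub]
      exact Submodule.sub_mem _ ha₁ hx
    · intro w hw
      obtain ⟨v, hv, rfl⟩ := hlift w hw
      have h1 : ∀ y y' w : TangentSpace B.MO.I (B.πN n),
          B.ωMO (B.πN n) (y - y') w = B.ωMO (B.πN n) y w - B.ωMO (B.πN n) y' w := by
        intro y y' w
        simp only [OrbitReduction.ωMO, ContinuousLinearMap.map_sub, sub_apply]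
      rw [h1, hω, h v hv, hH v hv, sub_self]

/-! ### The unreduced dynamics -/

/-- The constraint form pulled back to the model space of `M`. -/
noncomputable def DistributionalRCH.omegaM (T : DistributionalRCH S) (m : T.M) :
    T.M.E →ₗ[ℝ] T.M.E →ₗ[ℝ] ℝ :=
  LinearMap.mk₂ ℝ
    (fun x y => Q.omega (T.iM m) (mfderiv T.M.I Q.CI T.iM m x) (mfderiv T.M.I Q.CI T.iM m y))
    (fun x x' y => by
      have h : mfderiv T.M.I Q.CI T.iM m (x + x') =
        mfderiv T.M.I Q.CI T.iM m x + mfderiv T.M.I Q.CI T.iM m x' :=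
          ContinuousLinearMap.map_add _ x x'
      rw [h, Q.omega_swap, Q.omega_add_right, neg_add, ← Q.omega_swap, ← Q.omega_swap])
    (fun r x y => by
      have h : mfderiv T.M.I Q.CI T.iM m (r • x) = r • mfderiv T.M.I Q.CI T.iM m x :=
          ContinuousLinearMap.map_smul _ r x
      rw [h, Q.omega_smul_left, smul_eq_mul])
    (fun x y y' => by
      have h : mfderiv T.M.I Q.CI T.iM m (y + y') =
        mfderiv T.M.I Q.CI T.iM m y + mfderiv T.M.I Q.CI T.iM m y' :=
          ContinuousLinearMap.map_add _ y y'
      rw [h, Q.omega_add_right])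
    (fun r x y => by
      have h : mfderiv T.M.I Q.CI T.iM m (r • y) = r • mfderiv T.M.I Q.CI T.iM m y :=
          ContinuousLinearMap.map_smul _ r y
      rw [h, Q.omega_swap, Q.omega_smul_left, Q.omega_swap, smul_eq_mul]
      ring)

/-- If a one-form takes values in `M`, then the force and the control are vertical along it, and a
vector of its image over the constraint satisfying the Hamiltonian equation on the image of the
constraint is the value of `X_K`. -/
theorem DistributionalRCH.eq_XK_of_omega_eq (T : DistributionalRCH S)
    {γM : Q → T.M} (hγM : ContMDiff Q.I T.M.I ∞ γM) (hπγ : ∀ q, Q.proj (T.iM (γM q)) = q)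
    (q : Q) (w : TangentSpace Q.I q)
    (hw : (⟨q, w⟩ : TangentBundle Q.I Q) =
      tangentMap Q.CI Q.I Q.proj (T.Xtilde (γM q)))
    (h : ∀ d ∈ S.D q, Q.omega (T.iM (γM q))
        (mfderiv T.M.I Q.CI T.iM (γM q) (mfderiv Q.I T.M.I γM q w))
        (mfderiv T.M.I Q.CI T.iM (γM q) (mfderiv Q.I T.M.I γM q d)) =
      Q.omega (T.iM (γM q)) (mfderiv T.M.I Q.CI T.iM (γM q) (T.XK (γM q)))
        (mfderiv T.M.I Q.CI T.iM (γM q) (mfderiv Q.I T.M.I γM q d))) :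
    mfderiv Q.I T.M.I γM q w = T.XK (γM q) := by
  set m := γM q with hm
  have hiMd : MDifferentiableAt T.M.I Q.CI T.iM m := (T.submanifold.smooth.mdifferentiable (by simp)) m
  let ι : T.M.E →ₗ[ℝ] Q.E × (Q.E →L[ℝ] ℝ) :=
    (show T.M.E →L[ℝ] Q.E × (Q.E →L[ℝ] ℝ) from mfderiv T.M.I Q.CI T.iM m).toLinearMap
  let π' : Q.E × (Q.E →L[ℝ] ℝ) →ₗ[ℝ] Q.E :=
    (show Q.E × (Q.E →L[ℝ] ℝ) →L[ℝ] Q.E from mfderiv Q.CI Q.I Q.proj (T.iM m)).toLinearMap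
  let τ : T.M.E →ₗ[ℝ] Q.E := π' ∘ₗ ι
  let c : Q.E →ₗ[ℝ] T.M.E := (show Q.E →L[ℝ] T.M.E from mfderiv Q.I T.M.I γM q).toLinearMap
  let D : Submodule ℝ Q.E := S.D (Q.proj (T.iM m))
  have hD : D = S.D q := by
    have : ∀ q' : Q, q' = q → (show Submodule ℝ Q.E from S.D q') = S.D q := by
      rintro _ rfl; rfl
    exact this _ (hπγ q)
  have hτc : ∀ x, τ (c x) = x := by
    intro x
    have h1 : (Q.proj ∘ T.iM) ∘ γM = id := funext hπγ
    have h2 := mfderiv_comp_apply (I' := T.M.I) (v := x) q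
      ((Q.mdifferentiableAt_proj _).comp _ hiMd) ((hγM.mdifferentiable (by simp)) q)
    have h3 := mfderiv_comp_apply (I' := Q.CI) (v := c x) m (Q.mdifferentiableAt_proj _) hiMd
    have h4 : mfderiv Q.I Q.I ((Q.proj ∘ T.iM) ∘ γM) q = ContinuousLinearMap.id ℝ Q.E := by
      rw [h1, mfderiv_id]
      rfl
    exact (h2.trans h3).symm.trans (congrArg (fun A : Q.E →L[ℝ] Q.E => A x) h4)
  have hiso : ∀ x y, τ x = 0 → τ y = 0 → T.omegaM m x y = 0 := fun x y hx hy =>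
    Q.omega_of_vertical _ _ _ hx hy
  have hskew : ∀ x y, T.omegaM m y x = -T.omegaM m x y := fun x y => Q.omega_swap _ _ _
  have hnd : ∀ x, τ x ∈ D → (∀ y, τ y ∈ D → T.omegaM m x y = 0) → x = 0 :=
    fun x hx hy => T.nondegenerate m x hx hy
  -- Admissibility gives dim M = rank F, and F is the preimage of D under a surjection from a space
  -- of dimension 2 dim Q.
  have hdim : Module.finrank ℝ T.M.E = Module.finrank ℝ Q.E + Module.finrank ℝ D := by
    have h1 := T.admissible m
    have h2 : Module.finrank ℝ (D.comap π') + Module.finrank ℝ Q.E =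
        Module.finrank ℝ (Q.E × (Q.E →L[ℝ] ℝ)) + Module.finrank ℝ D :=
      finrank_comap_of_surjective fun x => ⟨ι (c x), hτc x⟩
    have h3 : Module.finrank ℝ (D.comap π') = Module.finrank ℝ (S.distF (T.iM m)) := rfl
    have h4 : Module.finrank ℝ (Q.E →L[ℝ] ℝ) = Module.finrank ℝ Q.E := by
      rw [← (LinearMap.toContinuousLinearMap (𝕜 := ℝ) (E := Q.E) (F' := ℝ)).finrank_eq]
      exact Subspace.dual_finrank_eq
    have h5 : Module.finrank ℝ T.M.E = T.M.dim := by simp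
    rw [Module.finrank_prod, h4] at h2
    omega
  have hvl : ∀ (F : ∀ x : Q, Q.CotFiber x → Q.CotFiber x) (y : T.M.E), τ y = 0 →
      Q.omega (T.iM m) (Q.vlift S.A F S.XH (T.iM m)) (ι y) = 0 := fun F y hy =>
    Q.omega_of_vertical _ _ _ (Q.mfderiv_proj_vertLift _ _ _) hy
  -- F_K pairs with vertical vectors of TM as the vertical lift does, that is, to zero;
  -- `vertical_of_orthogonal` then makes F_K itself vertical.
  have hF : τ (T.FK m) = 0 :=
    vertical_of_orthogonal hτc hiso hskew hnd hdim (T.FK_mem m) fun y hy =>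
      (T.FK_eq m y (by change τ y ∈ D; rw [hy]; exact D.zero_mem)).trans (hvl S.F y hy)
  have hu : τ (T.uK m) = 0 :=
    vertical_of_orthogonal hτc hiso hskew hnd hdim (T.uK_mem m) fun y hy =>
      (T.uK_eq m y (by change τ y ∈ D; rw [hy]; exact D.zero_mem)).trans (hvl S.u y hy)
  have hwτ : (w : Q.E) = τ (T.XK m) := by
    have h1 : ∀ a b : TangentBundle Q.I Q, a = b → (a.2 : Q.E) = b.2 := by
      rintro a _ rfl; rfl
    have h2 : (w : Q.E) = τ (T.XK m + T.FK m + T.uK m : T.M.E) := h1 _ _ hw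
    rw [h2]
    have h3 : τ (T.XK m + T.FK m + T.uK m : T.M.E) = τ (T.XK m) + τ (T.FK m) + τ (T.uK m) :=
      (τ.map_add _ _).trans (congrArg (· + _) (τ.map_add _ _))
    rw [h3, hF, hu, add_zero, add_zero]
  let X : T.M.E := T.XK m
  let w' : Q.E := w
  -- Both vectors lie over w, so their difference is vertical, and `h` makes it orthogonal to the
  -- image of D under γ.
  have hzero : c w' - X = 0 := by
    refine eq_zero_of_vertical_of_orthogonal (D := D) hτc hiso hnd ?_ fun d hd => ?_
    · rw [map_sub, hτc]
      exact sub_eq_zero.2 hwτ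
    · rw [map_sub, LinearMap.sub_apply, sub_eq_zero]
      exact h d (hD ▸ hd)
  exact sub_eq_zero.1 hzero

/-! ### Comparison of the two Hamilton-Jacobi equations -/

theorem DistributionalRCH.iM_lift (T : DistributionalRCH S) (z : Q.Cot)
    (hz : z ∈ S.constraintSet) : T.iM (T.lift z hz) = z :=
  (show z ∈ Set.range T.iM from T.submanifold.range_eq ▸ hz).choose_spec

theorem OrbitReduction.exists_red_eq (B : OrbitReduction S T μ) (z : Q.Cot)
    (hz : z ∈ S.constraintLevel μ) : ∃ n, B.iN n = z ∧ B.red z hz = B.πN n :=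
  ⟨_, (show z ∈ Set.range B.iN from B.submanifold_N.range_eq ▸ hz).choose_spec, rfl⟩

theorem OrbitReduction.red_eq (B : OrbitReduction S T μ) {z : Q.Cot}
    (hz : z ∈ S.constraintLevel μ) {n : B.N} (hn : B.iN n = z) : B.red z hz = B.πN n := by
  obtain ⟨n', hn', h⟩ := B.exists_red_eq z hz
  rw [h, B.submanifold_N.injective (hn'.trans hn.symm)]

/-- The two Type II Hamilton-Jacobi equations agree at the points of an invariant one-form. -/
theorem ReducedDistributionalRCH.hamiltonJacobi_iff (B : ReducedDistributionalRCH S T μ)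
    {γ : ∀ x : Q, Q.CotFiber x} (hγ_smooth : ContMDiff Q.I Q.CI ∞ (Q.sec γ))
    (hγ_inv : ∀ (g : G) (q : Q), Q.cotLift g (Q.sec γ q) = Q.sec γ (g • q))
    (hγ_J : ∀ q, S.J (Q.sec γ q) = μ)
    {k : B.N → B.P} (hk : ContMDiff B.N.I B.P.I ∞ k) (hik : ∀ n, B.iP (k n) = B.iN n)
    {j : B.N → T.M} (hj : ContMDiff B.N.I T.M.I ∞ j) (hij : ∀ n, T.iM (j n) = B.iN n)
    {γN : Q → B.N} (hγN : ContMDiff Q.I B.N.I ∞ γN) (hiγ : ∀ q, B.iN (γN q) = Q.sec γ q)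
    (hγ_K : ∀ (q : Q) (v : TangentSpace Q.I q),
      mfderiv Q.I B.MO.I (B.πN ∘ γN) q v ∈ B.KO (B.πN (γN q)))
    (q : Q) (w : TangentSpace Q.I q)
    (hw : (⟨q, w⟩ : TangentBundle Q.I Q) =
      tangentMap Q.CI Q.I Q.proj (T.Xtilde (j (γN q)))) :
    tangentMap Q.I Q.CI (Q.sec γ) ⟨q, w⟩ =
        tangentMap T.M.I Q.CI T.iM ⟨j (γN q), T.XK (j (γN q))⟩ ↔
      tangentMap Q.I B.MO.I (B.πN ∘ γN) ⟨q, w⟩ = ⟨B.πN (γN q), B.XKO (B.πN (γN q))⟩ := by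
  have hγNd := (hγN.mdifferentiable (by simp)) q
  have hjd := (hj.mdifferentiable (by simp)) (γN q)
  have hγM : ContMDiff Q.I T.M.I ∞ (j ∘ γN) := hj.comp hγN
  have hsec : Q.sec γ = T.iM ∘ (j ∘ γN) := funext fun q => ((hij _).trans (hiγ q)).symm
  have hcompM : ∀ v : TangentSpace Q.I q, mfderiv Q.I T.M.I (j ∘ γN) q v =
      mfderiv B.N.I T.M.I j (γN q) (mfderiv Q.I B.N.I γN q v) := fun v =>
    mfderiv_comp_apply (I' := B.N.I) (v := v) q hjd hγNd
  have hcompO : mfderiv Q.I B.MO.I (B.πN ∘ γN) q w =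
      mfderiv B.N.I B.MO.I B.πN (γN q) (mfderiv Q.I B.N.I γN q w) :=
    mfderiv_comp_apply (I' := B.N.I) (v := w) q
      ((B.submersion_N.smooth.mdifferentiable (by simp)) (γN q)) hγNd
  -- the unreduced equation in `TM`
  have h1 : tangentMap Q.I Q.CI (Q.sec γ) ⟨q, w⟩ =
        tangentMap T.M.I Q.CI T.iM ⟨j (γN q), T.XK (j (γN q))⟩ ↔
      mfderiv Q.I T.M.I (j ∘ γN) q w = T.XK (j (γN q)) := by
    rw [hsec, tangentMap_comp_at (I' := T.M.I) _
      ((T.submanifold.smooth.mdifferentiable (by simp)) _)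
      ((hγM.mdifferentiable (by simp)) q)]
    constructor
    · intro h
      exact T.submanifold.immersion _ (eq_of_heq (TotalSpace.mk.inj h).2)
    · intro h
      rw [← h]
      rfl
  -- the reduced equation in `TM_{O_μ}`
  have h2 : tangentMap Q.I B.MO.I (B.πN ∘ γN) ⟨q, w⟩ = ⟨B.πN (γN q), B.XKO (B.πN (γN q))⟩ ↔
      mfderiv B.N.I B.MO.I B.πN (γN q) (mfderiv Q.I B.N.I γN q w) = B.XKO (B.πN (γN q)) := by
    rw [← hcompO]
    constructor
    · intro h
      exact eq_of_heq (TotalSpace.mk.inj h).2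
    · intro h
      rw [← h]
      rfl
  have hK := hγ_K q w
  rw [hcompO] at hK
  rw [h1, h2, B.eq_XKO_iff hγ_smooth hγ_inv hγ_J hk hik hj hij hγN hiγ q _ hK]
  constructor
  · intro h v _
    rw [← h, hcompM]
  · intro h
    refine T.eq_XK_of_omega_eq hγM (fun q => ?_) q w hw fun d hd => ?_
    · rw [← Function.comp_apply (f := T.iM), ← hsec]
      rfl
    · rw [hcompM, hcompM]
      -- Tγ(d) is tangent to N and projects to d itself, because γ is a section; hence it lies in F
      -- ∩ TN.
      refine h _ ?_
      have hN : Q.proj ∘ B.iN ∘ γN = id := funext fun q => congrArg Q.proj (hiγ q)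
      rw [S.mfderiv_mem_distF_iff B.submanifold_N.smooth]
      have h3 := tangentMap_comp_of_contMDiff (Q.contMDiff_proj.comp B.submanifold_N.smooth) hγN
        ⟨q, d⟩
      have h4 : tangentMap Q.I Q.I ((Q.proj ∘ B.iN) ∘ γN) ⟨q, d⟩ = ⟨q, d⟩ := by
        have : (Q.proj ∘ B.iN) ∘ γN = id := hN
        rw [this, tangentMap_id]
        rfl
      have h5 := h3.symm.trans h4
      change tangentMap B.N.I Q.I (Q.proj ∘ B.iN) (tangentMap Q.I B.N.I γN ⟨q, d⟩) ∈ _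
      rw [h5]
      exact hd

end Systems

end SmoothMfd


theorem theorem5p12 (Q : SmoothMfd.{u}) (G : SmoothMfd.{v}) [Group G] [LieGroup G.I ∞ G]
    [MulAction G Q] (S : SmoothMfd.NonholonomicRCH Q G) (T : SmoothMfd.DistributionalRCH S)
    (μ : G.LieDual) (B : SmoothMfd.ReducedDistributionalRCH S T μ)
    (γ : ∀ x : Q, Q.CotFiber x) (hγ_smooth : ContMDiff Q.I Q.CI ∞ (Q.sec γ))
    (hγ_inv : ∀ (g : G) (q : Q), Q.cotLift g (Q.sec γ q) = Q.sec γ (g • q))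
    (hγ_J : ∀ q, S.J (Q.sec γ q) = μ)
    (hγ : ∀ q, Q.sec γ q ∈ S.constraintLevel μ)
    (hγ_K : ∀ (q : Q) (v : TangentSpace Q.I q),
      mfderiv Q.I B.MO.I (SmoothMfd.gammaBar B γ hγ) q v ∈
        B.KO (SmoothMfd.gammaBar B γ hγ q))
    (ε : Q.Cot → Q.Cot) (hε_sympl : Q.IsSymplecticMap ε)
    (hε_inv : ∀ (g : G) (z : Q.Cot), ε (Q.cotLift g z) = Q.cotLift g (ε z))
    (hε : ∀ z ∈ S.constraintLevel μ, ε z ∈ S.constraintLevel μ) :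
    SmoothMfd.SolvesTypeII B γ ε hε ↔ SmoothMfd.SolvesReducedTypeII B γ hγ ε hε := by
  obtain ⟨γN, hγN, hiγ⟩ := B.submanifold_N.exists_lift hγ_smooth hγ
  obtain ⟨j, hj, hij⟩ := T.submanifold.exists_lift B.submanifold_N.smooth
    (fun n => (B.iN_mem n).1)
  obtain ⟨k, hk, hik⟩ := B.submanifold_P.exists_lift B.submanifold_N.smooth
    (fun n => (B.iN_mem n).2)
  have hbar : SmoothMfd.gammaBar B γ hγ = B.πN ∘ γN := funext fun q => B.red_eq (hγ q) (hiγ q)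
  have hγ_K' : ∀ (q : Q) (v : TangentSpace Q.I q),
      mfderiv Q.I B.MO.I (B.πN ∘ γN) q v ∈ B.KO (B.πN (γN q)) := by
    intro q v
    have h := hγ_K q v
    rw [hbar] at h
    exact h
  have key : ∀ n : B.N,
      tangentMap Q.I Q.CI (Q.sec γ) (SmoothMfd.XtildeEps B ε hε n) = SmoothMfd.XKEps B ε hε n ↔
        tangentMap Q.I B.MO.I (SmoothMfd.gammaBar B γ hγ) (SmoothMfd.XtildeEps B ε hε n) =
          ⟨SmoothMfd.epsBar B ε hε n, B.XKO (SmoothMfd.epsBar B ε hε n)⟩ := by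
    intro n
    have hz := hε _ (B.iN_mem n)
    have hm : T.iM (T.lift (ε (B.iN n)) hz.1) = ε (B.iN n) := T.iM_lift _ hz.1
    obtain ⟨q, hq⟩ : ∃ q, q = (SmoothMfd.XtildeEps B ε hε n).1 := ⟨_, rfl⟩
    have hqz : q = Q.proj (ε (B.iN n)) := hq.trans (congrArg Q.proj hm)
    -- both equations force `ε` to take its value on the image of `γ`
    by_cases hbase : Q.sec γ q = ε (B.iN n)
    · have hmj : T.lift (ε (B.iN n)) hz.1 = j (γN q) := by
        apply T.submanifold.injective
        rw [hm, hij, hiγ, hbase]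
      have hx : SmoothMfd.epsBar B ε hε n = B.πN (γN q) := B.red_eq hz ((hiγ q).trans hbase)
      have hX : SmoothMfd.XtildeEps B ε hε n =
          tangentMap Q.CI Q.I Q.proj (T.Xtilde (j (γN q))) := by
        rw [← hmj]; rfl
      have hXK : SmoothMfd.XKEps B ε hε n =
          tangentMap T.M.I Q.CI T.iM ⟨j (γN q), T.XK (j (γN q))⟩ := by
        rw [← hmj]; rfl
      obtain ⟨w, hw⟩ : ∃ w : TangentSpace Q.I q,
          (⟨q, w⟩ : TangentBundle Q.I Q) = SmoothMfd.XtildeEps B ε hε n := by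
        subst hq
        exact ⟨_, rfl⟩
      rw [hx, hXK, ← hw, hbar]
      exact B.hamiltonJacobi_iff hγ_smooth hγ_inv hγ_J hk hik hj hij hγN hiγ hγ_K' q w
        (hw.trans hX)
    · refine iff_of_false (fun h => hbase ?_) (fun h => hbase ?_)
      · have h1 : Q.sec γ (SmoothMfd.XtildeEps B ε hε n).1 = T.iM (T.lift (ε (B.iN n)) hz.1) :=
          congrArg TotalSpace.proj h
        rw [hq, h1, hm]
      · have h1 : SmoothMfd.gammaBar B γ hγ (SmoothMfd.XtildeEps B ε hε n).1 =
            SmoothMfd.epsBar B ε hε n := congrArg TotalSpace.proj h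
        -- Equality in the quotient gives γ(g • q) = ε(z) for some g; both γ(q) and ε(z) lie over q,
        -- so g • q = q.
        obtain ⟨n', hn', hred⟩ := B.exists_red_eq _ hz
        rw [← hq, hbar] at h1
        obtain ⟨g, hg⟩ := (B.orbit_N (γN q) n').1 (h1.trans hred)
        rw [hiγ, hγ_inv, hn'] at hg
        have h2 : g • q = q := (congrArg Q.proj hg).trans hqz.symm
        rw [← hg, h2]
  exact forall_congr' key
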